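/- Let $p$ be a prime number, let $K$ be a finite extension of the field $\mathbb{Q}_p$ of $p$-adic numbers, and let $N/K$ be a fully ramified Galois extension with elementary abelian group $G=\mathrm{Gal}(N/K)\cong C_p^n$, where $n>1$. Let $v_N$ be the valuation of $N$, normalized so that $v_N(\pi_N)=1$ for a prime element $\pi_N$ of $N$, and for each integer $i\ge -1$ let $G_i=\{\sigma\in G : v_N((\sigma-1)\pi_N)\ge i+1\}$ be the $i$th ramification group. Suppose that $N/K$ has exactly one (lower) ramification break $b$, that is, $b$ is the only integer $i\ge -1$ with $G_i\supsetneq G_{i+1}$. Then every $\rho\in N$ with $v_N(\rho)\equiv b \pmod{p^n}$ generates a normal basis of $N$ over $K$, that is, the conjugates $\{\sigma\rho : \sigma\in G\}$ form a basis of $N$ as a vector space over $K$. -/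

import Mathlib

noncomputable section

namespace LocalNormalBasis

open Module

section Integers

variable (p : ℕ) [Fact p.Prime] (N : Type*) [Field N] [Algebra ℚ_[p] N]

/-- A `ℚ_[p]`-algebra is a `ℤ_[p]`-algebra by restriction of scalars. -/
instance (priority := 50) algebraPadicInt : Algebra ℤ_[p] N :=
  Algebra.compHom N (algebraMap ℤ_[p] ℚ_[p])

instance isScalarTower_padicInt : IsScalarTower ℤ_[p] ℚ_[p] N :=
  IsScalarTower.of_algebraMap_eq fun _ => rfl

/-- The ring of integers of a finite extension `N` of `ℚ_[p]`: the integral closure of `ℤ_[p]`. -/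
abbrev integers : Subalgebra ℤ_[p] N := integralClosure ℤ_[p] N

variable {N} in
theorem isIntegral_iff_spectralNorm_le_one [FiniteDimensional ℚ_[p] N] (x : N) :
    IsIntegral ℤ_[p] x ↔ spectralNorm ℚ_[p] N x ≤ 1 := by
  have hx : IsIntegral ℚ_[p] x := Algebra.IsIntegral.isIntegral x
  rw [spectralNorm, spectralValue_le_one_iff (minpoly.monic hx)]
  constructor
  · intro h n
    rw [minpoly.isIntegrallyClosed_eq_field_fractions' ℚ_[p] h, Polynomial.coeff_map]
    exact PadicInt.norm_le_one _
  · intro h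
    have hl : minpoly ℚ_[p] x ∈ Polynomial.lifts (algebraMap ℤ_[p] ℚ_[p]) := by
      rw [Polynomial.lifts_iff_coeff_lifts]
      exact fun n => ⟨⟨_, h n⟩, rfl⟩
    obtain ⟨q, hq, -, hm⟩ := Polynomial.lifts_and_degree_eq_and_monic hl (minpoly.monic hx)
    refine ⟨q, hm, ?_⟩
    have h0 : Polynomial.aeval x (q.map (algebraMap ℤ_[p] ℚ_[p])) = 0 := by
      rw [hq, minpoly.aeval]
    rwa [Polynomial.aeval_map_algebraMap] at h0

theorem integers_not_isField : ¬ IsField (integers p N) := by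
  intro h
  have hinj : Function.Injective (algebraMap ℤ_[p] (integers p N)) := by
    have h2 : Function.Injective (algebraMap ℤ_[p] N) := by
      rw [IsScalarTower.algebraMap_eq ℤ_[p] ℚ_[p] N]
      exact (algebraMap ℚ_[p] N).injective.comp (IsFractionRing.injective ℤ_[p] ℚ_[p])
    exact fun x y hxy => h2 (congrArg Subtype.val hxy)
  exact IsDiscreteValuationRing.not_isField ℤ_[p] (isField_of_isIntegral_of_isField hinj h)

variable [FiniteDimensional ℚ_[p] N]

instance integers_isFractionRing : IsFractionRing (integers p N) N :=
  integralClosure.isFractionRing_of_finite_extension ℚ_[p] N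

instance integers_isDedekindDomain : IsDedekindDomain (integers p N) :=
  integralClosure.isDedekindDomain ℤ_[p] ℚ_[p] N

instance integers_isLocalRing : IsLocalRing (integers p N) := by
  refine IsLocalRing.of_isUnit_or_isUnit_one_sub_self fun a => ?_
  have key : ∀ c : integers p N, 1 ≤ spectralNorm ℚ_[p] N (c : N) → IsUnit c := by
    intro c hc
    have hc0 : (c : N) ≠ 0 := by
      intro h
      rw [h, spectralNorm_zero] at hc
      linarith
    have hmul : spectralNorm ℚ_[p] N (c : N) * spectralNorm ℚ_[p] N (c : N)⁻¹ = 1 := by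
      have h := map_mul (spectralMulAlgNorm ℚ_[p] N) (c : N) (c : N)⁻¹
      rw [mul_inv_cancel₀ hc0, map_one] at h
      exact h.symm
    have hi : IsIntegral ℤ_[p] (c : N)⁻¹ := by
      rw [isIntegral_iff_spectralNorm_le_one]
      nlinarith [spectralNorm_nonneg (K := ℚ_[p]) (L := N) (c : N)⁻¹]
    exact IsUnit.of_mul_eq_one ⟨(c : N)⁻¹, hi⟩ (Subtype.ext (mul_inv_cancel₀ hc0))
  have hna : IsNonarchimedean (spectralNorm ℚ_[p] N) := isNonarchimedean_spectralNorm
  have h1 := hna (a : N) (1 - a : N)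
  rw [add_sub_cancel, spectralNorm_one, le_max_iff] at h1
  rcases h1 with h1 | h1
  · exact Or.inl (key a h1)
  · exact Or.inr (key (1 - a) h1)

instance integers_isDiscreteValuationRing : IsDiscreteValuationRing (integers p N) :=
  ((IsDiscreteValuationRing.TFAE (integers p N) (integers_not_isField p N)).out 0 2).mpr
    (integers_isDedekindDomain p N)

open Classical in
/-- The normalized additive valuation `v_N : N → ℤ ∪ {∞}` of a finite extension `N` of `ℚ_[p]`,
attached to the maximal ideal of its ring of integers (`exp (-k)` in Mathlib's multiplicative
adic valuation corresponds to `k`). -/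
def val (x : N) : WithTop ℤ :=
  if x = 0 then ⊤ else
    ((-WithZero.log ((IsDiscreteValuationRing.maximalIdeal (integers p N)).valuation N x) : ℤ) :
      WithTop ℤ)

end Integers

section Extension

variable (p : ℕ) [Fact p.Prime] (K N : Type*) [Field K] [Algebra ℚ_[p] K] [FiniteDimensional ℚ_[p] K]
  [Field N] [Algebra ℚ_[p] N] [FiniteDimensional ℚ_[p] N] [Algebra K N]

/-- `N / K` is fully ramified: its ramification index, the value of `v_N` on a prime element
of `K`, is `[N : K]`. -/
def IsFullyRamified : Prop :=
  ∀ ϖ : K, val p K ϖ = 1 → val p N (algebraMap K N ϖ) = (finrank K N : ℤ)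

variable {N}

/-- `G_i = {σ ∈ Gal(N/K) : v_N((σ - 1) π_N) ≥ i + 1}`, for a prime element `π` of `N`. -/
def ramificationGroup (π : N) (i : ℤ) : Set Gal(N/K) :=
  {σ | ((i + 1 : ℤ) : WithTop ℤ) ≤ val p N (σ π - π)}

/-- The lower ramification breaks: the integers `b ≥ -1` with `G_b ⊋ G_{b+1}`. -/
def lowerBreaks (π : N) : Set ℤ :=
  {b | -1 ≤ b ∧ ramificationGroup p K π (b + 1) ⊂ ramificationGroup p K π b}

end Extension

/-- The conjugates of `ρ` under `Gal(N/K)` form a basis of `N` over `K`. -/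
def GeneratesNormalBasis (K : Type*) {N : Type*} [Field K] [Field N] [Algebra K N] (ρ : N) : Prop :=
  LinearIndependent K (fun σ : Gal(N/K) => σ ρ) ∧
    Submodule.span K (Set.range fun σ : Gal(N/K) => σ ρ) = ⊤

end LocalNormalBasis

end

/-! Let `V` be the `K`-span of the conjugates of `ρ`. It is stable under `G`, and by counting it
suffices to show `V = N`. This is reduced to degree `p`: for a subgroup `H` of index `p` and order
`q`, with fixed field `F`, the trace `θ` of `ρ` to `F` lies in `V`. Euler's trace formula gives `v θ
= v ρ + (q - 1) b` (`map_sum_subgroup`), so in the normalization of `F` the value of `θ` is again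
congruent to `b`, now modulo `p`.

The break of `F / K` is still `b` (`map_gal_prod_subgroup_sub`, `map_gal_sub_fixedField`). When `p ∤
b`, applying `τ - 1` repeatedly to `θ` raises the normalized value by exactly `b` each time: the
values met before the last step are congruent to `b, 2b, …, (p - 1)b`, all prime to `p`. The `p`
iterates have distinct values modulo `p`, hence form a `K`-basis of `F`, and `F ⊆ V`
(`mem_of_mem_fixedField`). Averaging over hyperplanes of `G` shows that the fields `F` together span
`N` (`eq_top_of_fixedField_le`).

There remains `p ∤ b`, where `n > 1` is essential (`not_dvd_break`). Put `u_τ = (τ π - π) / π`. If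
`p ∣ b`, applying `(1 + (τ - 1)) ^ p = 1` to `π` forces `u_τ ^ (p - 1)` to agree with `-p` to first
order, for every `τ ≠ 1`. Thus `u_σ / u_τ` reduces to some `j` in the prime field, and `σ π` is
closer to `τ ^ j π` than a single break permits unless `σ = τ ^ j`. A noncyclic group has a `σ`
outside the powers of `τ`. -/

namespace LocalNormalBasis

/-! ### Additive valuations: estimates, integers, congruences modulo the maximal ideal. -/

section AddVal

variable {N : Type*} [Field N] {v : AddValuation N (WithTop ℤ)} {x y : N} {c d : ℤ}

theorem coe_add_le_mul (hx : (c : WithTop ℤ) ≤ v x) (hy : (d : WithTop ℤ) ≤ v y) :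
    ((c + d : ℤ) : WithTop ℤ) ≤ v (x * y) := by
  rw [v.map_mul, WithTop.coe_add]
  exact add_le_add hx hy

theorem map_mul_eq_coe (hx : v x = c) (hy : v y = d) : v (x * y) = ((c + d : ℤ) : WithTop ℤ) := by
  rw [v.map_mul, hx, hy, WithTop.coe_add]

theorem map_pow_eq_coe (hx : v x = c) (k : ℕ) : v (x ^ k) = ((k * c : ℤ) : WithTop ℤ) := by
  induction k with
  | zero => simp [v.map_one]
  | succ k ih =>
    rw [pow_succ, map_mul_eq_coe ih hx]
    congr 1
    push_cast
    ring

theorem ne_zero_of_map_eq_coe (hx : v x = c) : x ≠ 0 := by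
  rintro rfl
  rw [v.map_zero] at hx
  exact WithTop.top_ne_coe hx

theorem exists_map_eq_coe (v : AddValuation N (WithTop ℤ)) (hx : x ≠ 0) : ∃ c : ℤ, v x = c :=
  (WithTop.ne_top_iff_exists.mp ((v.ne_top_iff).mpr hx)).imp fun _ h => h.symm

theorem coe_le_of_map_eq (hx : v x = c) (h : d ≤ c) : (d : WithTop ℤ) ≤ v x := by
  rw [hx]
  exact_mod_cast h

theorem le_of_coe_le (hx : v x = c) (h : (d : WithTop ℤ) ≤ v x) : d ≤ c := by
  rw [hx] at h
  exact_mod_cast h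

theorem map_eq_unique (hx : v x = c) (hx' : v x = d) : c = d := by
  rw [hx] at hx'
  exact_mod_cast hx'

theorem coe_le_mono (hx : (c : WithTop ℤ) ≤ v x) (h : d ≤ c) : (d : WithTop ℤ) ≤ v x :=
  le_trans (by exact_mod_cast h) hx

theorem map_div_eq_coe (hx : v x = c) (hy : v y = d) : v (x / y) = ((c - d : ℤ) : WithTop ℤ) := by
  have hy0 := ne_zero_of_map_eq_coe hy
  obtain ⟨e, he⟩ := exists_map_eq_coe v (div_ne_zero (ne_zero_of_map_eq_coe hx) hy0)
  have h := map_mul_eq_coe he hy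
  rw [div_mul_cancel₀ _ hy0] at h
  rw [he, map_eq_unique hx h]
  congr 1
  ring

theorem coe_sub_le_div (hx : (c : WithTop ℤ) ≤ v x) (hy : v y = d) :
    ((c - d : ℤ) : WithTop ℤ) ≤ v (x / y) := by
  by_cases h0 : x = 0
  · simp [h0, v.map_zero]
  · obtain ⟨e, he⟩ := exists_map_eq_coe v h0
    exact coe_le_of_map_eq (map_div_eq_coe he hy) (by linarith [le_of_coe_le he hx])

theorem coe_le_pow (hx : (c : WithTop ℤ) ≤ v x) (k : ℕ) :
    ((k * c : ℤ) : WithTop ℤ) ≤ v (x ^ k) := by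
  induction k with
  | zero => simp [v.map_one]
  | succ k ih =>
    rw [pow_succ]
    refine coe_le_mono (coe_add_le_mul ih hx) (le_of_eq ?_)
    push_cast
    ring

theorem map_eq_of_coe_le_sub (hx : v x = c) (h : ((c + 1 : ℤ) : WithTop ℤ) ≤ v (y - x)) :
    v y = c := by
  rw [← hx]
  refine v.map_eq_of_lt_sub (lt_of_lt_of_le ?_ h)
  rw [hx]
  exact_mod_cast lt_add_one c

theorem zero_le_map_natCast (v : AddValuation N (WithTop ℤ)) (k : ℕ) :
    ((0 : ℤ) : WithTop ℤ) ≤ v (k : N) := by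
  induction k with
  | zero => simp [v.map_zero]
  | succ k ih =>
    push_cast
    exact v.map_le_add ih (by simp [v.map_one])

theorem zero_le_map_intCast (v : AddValuation N (WithTop ℤ)) (k : ℤ) :
    ((0 : ℤ) : WithTop ℤ) ≤ v (k : N) := by
  obtain ⟨m, rfl | rfl⟩ := k.eq_nat_or_neg
  · simpa using zero_le_map_natCast v m
  · simpa [v.map_neg] using zero_le_map_natCast v m

theorem one_le_map_intCast_of_dvd {p : ℕ} (hp : ((1 : ℤ) : WithTop ℤ) ≤ v (p : N)) {k : ℤ}
    (hk : (p : ℤ) ∣ k) : ((1 : ℤ) : WithTop ℤ) ≤ v (k : N) := by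
  obtain ⟨m, rfl⟩ := hk
  simpa using coe_add_le_mul hp (zero_le_map_intCast v m)

theorem map_intCast_of_not_dvd {p : ℕ} [Fact p.Prime] (hp : ((1 : ℤ) : WithTop ℤ) ≤ v (p : N))
    {k : ℤ} (hk : ¬ (p : ℤ) ∣ k) : v (k : N) = ((0 : ℤ) : WithTop ℤ) := by
  obtain ⟨r, s, hrs⟩ : IsCoprime (p : ℤ) k :=
    ((Nat.prime_iff_prime_int.mp Fact.out).coprime_iff_not_dvd).mpr hk
  have h1 : ((s * k : ℤ) : N) - 1 = ((-r * p : ℤ) : N) := by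
    rw [← Int.cast_one (R := N), ← Int.cast_sub]
    congr 1
    linarith
  have h2 : v ((s * k : ℤ) : N) = ((0 : ℤ) : WithTop ℤ) := by
    refine map_eq_of_coe_le_sub (x := 1) (by simp [v.map_one]) ?_
    rw [h1]
    exact one_le_map_intCast_of_dvd hp ⟨-r, by ring⟩
  have hk0 : (k : N) ≠ 0 := by
    intro h
    exact ne_zero_of_map_eq_coe h2 (by push_cast; rw [h, mul_zero])
  obtain ⟨c, hc⟩ := exists_map_eq_coe v hk0
  have h3 := le_of_coe_le hc (zero_le_map_intCast v k)
  have h4 : ((0 + c : ℤ) : WithTop ℤ) ≤ v ((s * k : ℤ) : N) := by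
    push_cast
    exact coe_add_le_mul (by simpa using zero_le_map_intCast v s) hc.ge
  have h5 := le_of_coe_le h2 h4
  rw [hc]
  congr 1
  omega

/-- A sum of terms of pairwise distinct valuation has the least of these valuations. -/
theorem exists_map_sum_eq {ι : Type*} {s : Finset ι} (hs : s.Nonempty) {f : ι → N}
    (h : ∀ i ∈ s, ∀ j ∈ s, i ≠ j → f i ≠ 0 → v (f i) ≠ v (f j)) :
    ∃ i ∈ s, v (∑ j ∈ s, f j) = v (f i) ∧ ∀ j ∈ s, v (f i) ≤ v (f j) := by
  classical
  obtain ⟨i, hi, hmin⟩ := s.exists_min_image (fun j => v (f j)) hs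
  refine ⟨i, hi, ?_, hmin⟩
  by_cases h0 : f i = 0
  · have hz : ∀ j ∈ s, f j = 0 := fun j hj => by
      have := hmin j hj
      rw [h0, v.map_zero, top_le_iff] at this
      exact v.top_iff.mp this
    rw [Finset.sum_eq_zero hz, h0]
  · refine v.map_eq_of_lt_sub ?_
    rw [← Finset.add_sum_erase s f hi, add_sub_cancel_left]
    refine v.map_lt_sum ((v.ne_top_iff).mpr h0) fun j hj => ?_
    have hj' := Finset.mem_erase.mp hj
    exact lt_of_le_of_ne (hmin j hj'.2) (h i hi j hj'.2 (Ne.symm hj'.1) h0)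

theorem zero_le_map_aeval {r : N} (hr : ((0 : ℤ) : WithTop ℤ) ≤ v r) (P : Polynomial ℤ) :
    ((0 : ℤ) : WithTop ℤ) ≤ v (Polynomial.aeval r P) := by
  rw [Polynomial.aeval_eq_sum_range]
  refine v.map_le_sum fun i _ => ?_
  rw [zsmul_eq_mul]
  simpa using coe_add_le_mul (zero_le_map_intCast v _) (coe_le_pow hr i)

/-- Such a `P` is `p` times an integral polynomial. This transfers identities of `𝔽_p[X]` to
congruences in `N` without introducing the residue field. -/
theorem one_le_map_aeval_of_map_eq_zero {p : ℕ} (hp : ((1 : ℤ) : WithTop ℤ) ≤ v (p : N)) {r : N}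
    (hr : ((0 : ℤ) : WithTop ℤ) ≤ v r) {P : Polynomial ℤ}
    (hP : P.map (Int.castRingHom (ZMod p)) = 0) :
    ((1 : ℤ) : WithTop ℤ) ≤ v (Polynomial.aeval r P) := by
  obtain ⟨Q, rfl⟩ : Polynomial.C (p : ℤ) ∣ P := by
    rw [Polynomial.C_dvd_iff_dvd_coeff]
    intro i
    rw [← ZMod.intCast_zmod_eq_zero_iff_dvd]
    simpa using congrArg (fun R => R.coeff i) hP
  simpa using coe_add_le_mul hp (zero_le_map_aeval hr Q)

/-- If `r ^ p ≡ r` modulo the maximal ideal then `r` is congruent to an integer. -/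
theorem exists_natCast_of_pow_sub {p : ℕ} [Fact p.Prime]
    (hp : ((1 : ℤ) : WithTop ℤ) ≤ v (p : N)) {r : N} (hr : ((0 : ℤ) : WithTop ℤ) ≤ v r)
    (h : ((1 : ℤ) : WithTop ℤ) ≤ v (r ^ p - r)) :
    ∃ j : ℕ, ((1 : ℤ) : WithTop ℤ) ≤ v (r - j) := by
  have hprod : ∏ j : ZMod p, (Polynomial.X - Polynomial.C j) =
      (Polynomial.X ^ p - Polynomial.X : Polynomial (ZMod p)) := by
    have hroots := FiniteField.roots_X_pow_card_sub_X (ZMod p)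
    rw [ZMod.card] at hroots
    have hp1 : 1 < p := (Fact.out : p.Prime).one_lt
    have hdeg := FiniteField.X_pow_card_sub_X_natDegree_eq (ZMod p) hp1
    have := Polynomial.prod_multiset_X_sub_C_of_monic_of_roots_card_eq
      (p := (Polynomial.X ^ p - Polynomial.X : Polynomial (ZMod p)))
      (Polynomial.monic_X_pow_sub (by simpa using hp1))
      (by rw [hroots, hdeg, Finset.card_val, Finset.card_univ, ZMod.card])
    rw [hroots] at this
    exact this
  have hmap : (∏ j : ZMod p, (Polynomial.X - Polynomial.C (j.val : ℤ)) -
      (Polynomial.X ^ p - Polynomial.X)).map (Int.castRingHom (ZMod p)) = 0 := by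
    simp only [Polynomial.map_sub, Polynomial.map_prod, Polynomial.map_X, Polynomial.map_C,
      Polynomial.map_pow]
    simp only [eq_intCast, Int.cast_natCast, ZMod.natCast_zmod_val, hprod, sub_self]
  have h1 := one_le_map_aeval_of_map_eq_zero hp hr hmap
  have h2 : ((1 : ℤ) : WithTop ℤ) ≤ v (∏ j : ZMod p, (r - (j.val : ℕ))) := by
    have := v.map_le_add h1 h
    simpa [-ZMod.natCast_val, map_prod] using this
  -- Otherwise every factor `r - j` has value `0`, and so has the product, which is congruent to `r
  -- ^ p - r`.
  by_contra! hcon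
  have h3 : ∀ j : ℕ, v (r - j) = ((0 : ℤ) : WithTop ℤ) := by
    intro j
    have hj := hcon j
    obtain ⟨c, hc⟩ := exists_map_eq_coe v (x := r - j) (by
      intro h0
      rw [h0, v.map_zero] at hj
      exact not_top_lt hj)
    have h0 := le_of_coe_le hc (v.map_le_sub hr (zero_le_map_natCast v j))
    rw [hc] at hj ⊢
    have : c < 1 := by exact_mod_cast hj
    congr 1
    omega
  have h4 : ∀ s : Finset (ZMod p), v (∏ j ∈ s, (r - (j.val : ℕ))) = ((0 : ℤ) : WithTop ℤ) := by
    intro s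
    induction s using Finset.cons_induction with
    | empty => simp [v.map_one]
    | cons a s ha ih => rw [Finset.prod_cons, map_mul_eq_coe (h3 _) ih, add_zero]
  have := le_of_coe_le (h4 Finset.univ) h2
  omega

theorem coe_le_one_add_pow_sub_one {u : N} (hc : 0 ≤ c) (hu : (c : WithTop ℤ) ≤ v u) (j : ℕ) :
    (c : WithTop ℤ) ≤ v ((1 + u) ^ j - 1) := by
  have h1 : ((0 : ℤ) : WithTop ℤ) ≤ v (1 + u) :=
    v.map_le_add (by simp [v.map_one]) (coe_le_mono hu hc)
  induction j with
  | zero => simp [v.map_zero]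
  | succ j ih =>
    have : (1 + u) ^ (j + 1) - 1 = ((1 + u) ^ j - 1) * (1 + u) + u := by ring
    rw [this]
    exact v.map_le_add (by simpa using coe_add_le_mul ih h1) hu

theorem coe_le_one_add_pow_sub {u : N} (hc : 0 ≤ c) (hu : (c : WithTop ℤ) ≤ v u) (j : ℕ) :
    ((c + c : ℤ) : WithTop ℤ) ≤ v ((1 + u) ^ j - 1 - j * u) := by
  have h1 : ((0 : ℤ) : WithTop ℤ) ≤ v (1 + u) :=
    v.map_le_add (by simp [v.map_one]) (coe_le_mono hu hc)
  induction j with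
  | zero => simp [v.map_zero]
  | succ j ih =>
    have : (1 + u) ^ (j + 1) - 1 - (j + 1 : ℕ) * u =
        ((1 + u) ^ j - 1 - j * u) * (1 + u) + j * (u * u) := by push_cast; ring
    rw [this]
    refine v.map_le_add ?_ ?_
    · exact coe_le_mono (coe_add_le_mul ih h1) (by omega)
    · exact coe_le_mono (coe_add_le_mul (zero_le_map_natCast v j) (coe_add_le_mul hu hu))
        (by omega)

/-! ### Expansions along elements with values distinct modulo those of a subfield. -/

section Expansion

variable {F : Type*} [Field F] [Algebra F N] {D : ℤ} {ι : Type*} [Fintype ι] {e : ι → N} {k : ι → ℤ}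

/-- Scalars change values only by multiples of `D`, so two nonzero terms never tie and the smallest
one governs the sum. -/
theorem exists_map_sum_smul_eq [Nonempty ι]
    (hF : ∀ a : F, a ≠ 0 → ∃ t : ℤ, v (algebraMap F N a) = ((D * t : ℤ) : WithTop ℤ))
    (he : ∀ i, v (e i) = k i) (hk : ∀ i j, k i ≡ k j [ZMOD D] → i = j) (a : ι → F) :
    ∃ i, v (∑ j, a j • e j) = v (a i • e i) ∧ (∀ j, v (a i • e i) ≤ v (a j • e j)) ∧
      ∀ j, j ≠ i → v (a i • e i) ≠ ⊤ → v (a i • e i) < v (a j • e j) := by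
  have hne : ∀ i ∈ Finset.univ, ∀ j ∈ Finset.univ, i ≠ j → a i • e i ≠ 0 →
      v (a i • e i) ≠ v (a j • e j) := by
    intro i _ j _ hij hi0 heq
    have hi : a i ≠ 0 := fun h => hi0 (by rw [h, zero_smul])
    have hj : a j ≠ 0 := fun h => by
      rw [h, zero_smul, v.map_zero] at heq
      exact hi0 (v.top_iff.mp heq)
    obtain ⟨s, hs⟩ := hF _ hi
    obtain ⟨t, ht⟩ := hF _ hj
    rw [Algebra.smul_def, Algebra.smul_def, map_mul_eq_coe hs (he i)] at heq
    have := map_eq_unique heq.symm (map_mul_eq_coe ht (he j))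
    refine hij (hk i j ((Int.modEq_iff_dvd).mpr ⟨s - t, ?_⟩))
    linear_combination -this
  obtain ⟨i, -, h1, h2⟩ := exists_map_sum_eq Finset.univ_nonempty hne
  refine ⟨i, h1, fun j => h2 j (Finset.mem_univ j), fun j hj htop =>
    lt_of_le_of_ne (h2 j (Finset.mem_univ j)) ?_⟩
  exact hne i (Finset.mem_univ i) j (Finset.mem_univ j) hj.symm (v.ne_top_iff.mp htop)

theorem linearIndependent_of_map_eq
    (hF : ∀ a : F, a ≠ 0 → ∃ t : ℤ, v (algebraMap F N a) = ((D * t : ℤ) : WithTop ℤ))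
    (he : ∀ i, v (e i) = k i) (hk : ∀ i j, k i ≡ k j [ZMOD D] → i = j) :
    LinearIndependent F e := by
  rw [Fintype.linearIndependent_iff]
  intro a ha i
  have : Nonempty ι := ⟨i⟩
  obtain ⟨j, h1, h2, -⟩ := exists_map_sum_smul_eq hF he hk a
  have h3 := h2 i
  rw [← h1, ha, v.map_zero, top_le_iff, v.top_iff, smul_eq_zero] at h3
  exact h3.resolve_right (ne_zero_of_map_eq_coe (he i))

/-- Expansion of `x` along elements whose valuations are distinct modulo the values of `F`. -/
theorem exists_expansion [FiniteDimensional F N]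
    (hF : ∀ a : F, a ≠ 0 → ∃ t : ℤ, v (algebraMap F N a) = ((D * t : ℤ) : WithTop ℤ))
    (he : ∀ i, v (e i) = k i) (hk : ∀ i j, k i ≡ k j [ZMOD D] → i = j)
    {W : Submodule F N} (hW : Module.finrank F W = Fintype.card ι) (heW : ∀ i, e i ∈ W)
    {m : ℤ} (hxW : x ∈ W) (hx : v x = m) :
    ∃ (a : ι → F) (i : ι), x = ∑ j, a j • e j ∧ v (a i • e i) = m ∧ k i ≡ m [ZMOD D] ∧
      ∀ j, j ≠ i → ((m + 1 : ℤ) : WithTop ℤ) ≤ v (a j • e j) := by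
  have hind := linearIndependent_of_map_eq hF he hk
  have hspan : Submodule.span F (Set.range e) = W := by
    refine Submodule.eq_of_le_of_finrank_eq (Submodule.span_le.mpr ?_) ?_
    · rintro _ ⟨i, rfl⟩
      exact heW i
    · rw [finrank_span_eq_card hind, hW]
  rw [← hspan, Submodule.mem_span_range_iff_exists_fun] at hxW
  obtain ⟨a, ha⟩ := hxW
  have hne : Nonempty ι := by
    by_contra h
    rw [not_nonempty_iff] at h
    rw [Finset.univ_eq_empty, Finset.sum_empty] at ha
    exact ne_zero_of_map_eq_coe hx ha.symm
  obtain ⟨i, h1, -, h2⟩ := exists_map_sum_smul_eq hF he hk a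
  rw [ha, hx] at h1
  refine ⟨a, i, ha.symm, h1.symm, ?_, fun j hj => ?_⟩
  · have hi : a i ≠ 0 := by
      intro h
      rw [h, zero_smul, v.map_zero] at h1
      exact WithTop.coe_ne_top h1
    obtain ⟨t, ht⟩ := hF _ hi
    rw [Algebra.smul_def] at h1
    have h3 := map_eq_unique h1.symm (map_mul_eq_coe ht (he i))
    exact (Int.modEq_iff_dvd).mpr ⟨t, by linear_combination h3⟩
  · have h3 := h2 j hj (by rw [← h1]; exact WithTop.coe_ne_top)
    rw [← h1] at h3
    by_cases h0 : a j • e j = 0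
    · simp [h0, v.map_zero]
    · obtain ⟨c, hc⟩ := exists_map_eq_coe v h0
      rw [hc] at h3
      have : m < c := by exact_mod_cast h3
      exact coe_le_of_map_eq hc this

end Expansion

end AddVal

end LocalNormalBasis

/-! ### Single-break extensions: the first-order action of an automorphism. -/

namespace LocalNormalBasis

open Module

/-- `N / K` is totally ramified with respect to the additive valuation `v`, of residue
characteristic `p`, and every nontrivial automorphism moves the uniformizer `π` by exactly
`b + 1`. -/
structure HasSingleBreak (p : ℕ) (K : Type*) {N : Type*} [Field K] [Field N] [Algebra K N]
    (v : AddValuation N (WithTop ℤ)) (π : N) (b : ℤ) : Prop where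
  map_gal : ∀ (σ : Gal(N/K)) (x : N), v (σ x) = v x
  map_base : ∀ a : K, a ≠ 0 →
    ∃ t : ℤ, v (algebraMap K N a) = ((finrank K N * t : ℤ) : WithTop ℤ)
  map_prime : ((1 : ℤ) : WithTop ℤ) ≤ v (p : N)
  map_uniformizer : v π = ((1 : ℤ) : WithTop ℤ)
  map_sub : ∀ σ : Gal(N/K), σ ≠ 1 → v (σ π - π) = ((b + 1 : ℤ) : WithTop ℤ)

theorem fin_eq_of_modEq {D : ℕ} {i j : Fin D} (h : (i : ℤ) ≡ j [ZMOD D]) : i = j := by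
  have h1 := (Int.natCast_modEq_iff).mp h
  exact Fin.ext (Nat.ModEq.eq_of_lt_of_lt h1 i.2 j.2)

variable {p : ℕ} {K N : Type*} [Field K] [Field N] [Algebra K N]
  {v : AddValuation N (WithTop ℤ)} {π : N} {b : ℤ}

theorem exists_uniformizer_expansion [FiniteDimensional K N]
    (hK : ∀ a : K, a ≠ 0 → ∃ t : ℤ, v (algebraMap K N a) = ((finrank K N * t : ℤ) : WithTop ℤ))
    (hπ : v π = ((1 : ℤ) : WithTop ℤ)) {x : N} {m : ℤ} (hx : v x = m) :
    ∃ (a : Fin (finrank K N) → K) (i : Fin (finrank K N)),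
      x = ∑ j, a j • π ^ (j : ℕ) ∧ v (a i • π ^ (i : ℕ)) = m ∧ (i : ℤ) ≡ m [ZMOD finrank K N] ∧
      ∀ j, j ≠ i → ((m + 1 : ℤ) : WithTop ℤ) ≤ v (a j • π ^ (j : ℕ)) := by
  refine exists_expansion (W := ⊤) (k := fun i : Fin (finrank K N) => (i : ℤ)) hK (fun i => ?_)
    (fun i j h => fin_eq_of_modEq h) (by rw [finrank_top, Fintype.card_fin])
    (fun _ => Submodule.mem_top) Submodule.mem_top hx
  simpa using map_pow_eq_coe hπ (i : ℕ)

/-- By total ramification the powers of `π` span `N` over `K`. -/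
theorem gal_eq_one_of_map_uniformizer [FiniteDimensional K N]
    (hK : ∀ a : K, a ≠ 0 → ∃ t : ℤ, v (algebraMap K N a) = ((finrank K N * t : ℤ) : WithTop ℤ))
    (hπ : v π = ((1 : ℤ) : WithTop ℤ)) {σ : Gal(N/K)} (h : σ π = π) : σ = 1 := by
  ext x
  by_cases hx : x = 0
  · simp [hx]
  · obtain ⟨m, hm⟩ := exists_map_eq_coe v hx
    obtain ⟨a, -, rfl, -⟩ := exists_uniformizer_expansion hK hπ hm
    simp [h]

namespace HasSingleBreak

theorem map_quot (S : HasSingleBreak p K v π b) {τ : Gal(N/K)} (hτ : τ ≠ 1) :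
    v ((τ π - π) / π) = b := by
  rw [map_div_eq_coe (S.map_sub τ hτ) S.map_uniformizer]
  congr 1
  ring

theorem uniformizer_ne_zero (S : HasSingleBreak p K v π b) : π ≠ 0 :=
  ne_zero_of_map_eq_coe S.map_uniformizer

theorem gal_smul_pow (hπ : π ≠ 0) (τ : Gal(N/K)) (a : K) (j : ℕ) :
    τ (a • π ^ j) = a • π ^ j * (1 + (τ π - π) / π) ^ j := by
  have h : τ π = π * (1 + (τ π - π) / π) := by
    field_simp
    ring
  rw [map_smul, map_pow, h, mul_pow, smul_mul_assoc]
  congr 4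
  rw [← h]

theorem break_nonneg (S : HasSingleBreak p K v π b) {τ : Gal(N/K)} (hτ : τ ≠ 1) : 0 ≤ b := by
  have h := v.map_le_sub (g := ((1 : ℤ) : WithTop ℤ))
    ((S.map_gal τ π).trans S.map_uniformizer).ge S.map_uniformizer.ge
  linarith [le_of_coe_le (S.map_sub τ hτ) h]

variable [FiniteDimensional K N]

/-- The action on a totally ramified extension is trivial on the residue field. -/
theorem one_le_map_sub (S : HasSingleBreak p K v π b) (τ : Gal(N/K)) {x : N}
    (hx : ((0 : ℤ) : WithTop ℤ) ≤ v x) : ((1 : ℤ) : WithTop ℤ) ≤ v (τ x - x) := by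
  by_cases hx0 : x = 0
  · simp [hx0, v.map_zero]
  obtain ⟨m, hm⟩ := exists_map_eq_coe v hx0
  have hm0 := le_of_coe_le hm hx
  obtain ⟨a, i, hxe, hi, himod, hj⟩ :=
    exists_uniformizer_expansion S.map_base S.map_uniformizer hm
  have hterm : ∀ j, ((1 : ℤ) : WithTop ℤ) ≤ v (τ (a j • π ^ (j : ℕ)) - a j • π ^ (j : ℕ)) := by
    intro j
    by_cases hj0 : (j : ℕ) = 0
    · simp [hj0, v.map_zero]
    have h1 : ((1 : ℤ) : WithTop ℤ) ≤ v (a j • π ^ (j : ℕ)) := by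
      by_cases hji : j = i
      · subst hji
        refine coe_le_of_map_eq hi ?_
        by_contra hlt
        have hm00 : m = 0 := by omega
        rw [hm00, Int.modEq_zero_iff_dvd] at himod
        exact hj0 (Nat.eq_zero_of_dvd_of_lt (by exact_mod_cast himod) j.2)
      · exact coe_le_mono (hj j hji) (by omega)
    exact v.map_le_sub (by rwa [S.map_gal]) h1
  rw [hxe, map_sum, ← Finset.sum_sub_distrib]
  exact v.map_le_sum fun j _ => hterm j

/-- Excludes tame ramification: if `b = 0`, then `1 + u` is a `p`-th root of unity in characteristic
`p` modulo the maximal ideal, so `u` vanishes there, although `u` is a unit. -/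
theorem one_le_break [Fact p.Prime] (S : HasSingleBreak p K v π b) {τ : Gal(N/K)} (hτ : τ ≠ 1)
    (hτp : τ ^ p = 1) : 1 ≤ b := by
  by_contra hb
  have hb0 : b = 0 := le_antisymm (by omega) (S.break_nonneg hτ)
  subst hb0
  have hπ0 := S.uniformizer_ne_zero
  set u := (τ π - π) / π with hu
  have hvu : v u = ((0 : ℤ) : WithTop ℤ) := S.map_quot hτ
  have hz : τ π = π * (1 + u) := by
    rw [hu]
    field_simp
    ring
  have hvz : ((0 : ℤ) : WithTop ℤ) ≤ v (1 + u) := v.map_le_add (by simp [v.map_one]) hvu.ge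
  -- The factor `1 + u` is fixed by `τ` modulo the maximal ideal, so iterating `τ` just multiplies
  -- these factors.
  have hpow : ∀ k : ℕ, ((2 : ℤ) : WithTop ℤ) ≤ v ((τ ^ k) π - π * (1 + u) ^ k) := by
    intro k
    induction k with
    | zero => simp [v.map_zero]
    | succ k ih =>
      have h1 : (τ ^ (k + 1)) π - π * (1 + u) ^ (k + 1) =
          τ ((τ ^ k) π - π * (1 + u) ^ k) +
            π * (1 + u) * (τ ((1 + u) ^ k) - (1 + u) ^ k) := by
        rw [pow_succ', AlgEquiv.mul_apply, _root_.map_sub, _root_.map_mul, hz]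
        ring
      rw [h1]
      refine v.map_le_add (by rwa [S.map_gal]) ?_
      exact coe_add_le_mul (c := 1) (d := 1)
        (coe_add_le_mul (c := 1) (d := 0) S.map_uniformizer.ge hvz)
        (S.one_le_map_sub τ (by simpa using coe_le_pow hvz k))
  have h2 : ((1 : ℤ) : WithTop ℤ) ≤ v ((1 + u) ^ p - 1) := by
    have h3 := hpow p
    rw [hτp, AlgEquiv.one_apply] at h3
    have h4 := coe_sub_le_div h3 S.map_uniformizer
    have h5 : (1 + u) ^ p - 1 = -((π - π * (1 + u) ^ p) / π) := by
      field_simp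
      ring
    rw [h5, v.map_neg]
    exact h4
  have h6 : ((1 : ℤ) : WithTop ℤ) ≤ v ((1 + u) ^ p - 1 - u ^ p) := by
    have h7 := one_le_map_aeval_of_map_eq_zero S.map_prime hvu.ge
      (P := (1 + Polynomial.X) ^ p - 1 - Polynomial.X ^ p) (by
        simp only [Polynomial.map_sub, Polynomial.map_pow, Polynomial.map_add,
          Polynomial.map_one, Polynomial.map_X]
        rw [add_pow_char]
        ring)
    simpa using h7
  have h8 : ((1 : ℤ) : WithTop ℤ) ≤ v (u ^ p) := by
    have := v.map_le_sub h2 h6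
    rwa [sub_sub_cancel] at this
  have := le_of_coe_le (map_pow_eq_coe hvu p) h8
  omega

/-- For `x` of valuation `m`, `(τ - 1) x` is congruent to `m u x` with `u = (τ π - π) / π`. -/
theorem coe_le_map_sub_sub (S : HasSingleBreak p K v π b) (hpK : p ∣ finrank K N) (hb : 1 ≤ b)
    {τ : Gal(N/K)} (hτ : τ ≠ 1) {x : N} {m : ℤ} (hx : v x = m) :
    ((m + b + 1 : ℤ) : WithTop ℤ) ≤ v (τ x - x - m * ((τ π - π) / π) * x) := by
  have hπ0 := S.uniformizer_ne_zero
  have hvu := S.map_quot hτ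
  obtain ⟨a, i, hxe, hi, himod, hj⟩ :=
    exists_uniformizer_expansion S.map_base S.map_uniformizer hx
  have hterm : ∀ j, ((m + b + 1 : ℤ) : WithTop ℤ) ≤ v (τ (a j • π ^ (j : ℕ)) -
      a j • π ^ (j : ℕ) - m * ((τ π - π) / π) * (a j • π ^ (j : ℕ))) := by
    intro j
    rw [gal_smul_pow hπ0]
    generalize (τ π - π) / π = u at *
    -- In the leading term the exponent `i` may be replaced by `m`: they differ by a multiple of the
    -- degree, hence of `p`, which gains value at least `1`. The other terms already start at `m +
    -- 1`.
    by_cases hji : j = i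
    · subst hji
      have h1 : a j • π ^ (j : ℕ) * (1 + u) ^ (j : ℕ) - a j • π ^ (j : ℕ) -
          m * u * (a j • π ^ (j : ℕ)) = a j • π ^ (j : ℕ) *
            (((1 + u) ^ (j : ℕ) - 1 - (j : ℕ) * u) + (((j : ℤ) - m : ℤ) : N) * u) := by
        push_cast
        ring
      rw [h1, add_assoc]
      refine coe_add_le_mul hi.ge (v.map_le_add ?_ ?_)
      · exact coe_le_mono (coe_le_one_add_pow_sub (by omega) hvu.ge j) (by omega)
      · rw [add_comm b 1]
        refine coe_add_le_mul (one_le_map_intCast_of_dvd S.map_prime ?_) hvu.ge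
        exact (Int.natCast_dvd_natCast.mpr hpK).trans himod.symm.dvd
    · have h1 : a j • π ^ (j : ℕ) * (1 + u) ^ (j : ℕ) - a j • π ^ (j : ℕ) -
          m * u * (a j • π ^ (j : ℕ)) = a j • π ^ (j : ℕ) *
            (((1 + u) ^ (j : ℕ) - 1) - m * u) := by ring
      rw [h1, add_right_comm]
      refine coe_add_le_mul (hj j hji) (v.map_le_sub ?_ ?_)
      · exact coe_le_one_add_pow_sub_one (by omega) hvu.ge j
      · simpa using coe_add_le_mul (zero_le_map_intCast v m) hvu.ge
  conv => rw [hxe, map_sum, ← Finset.sum_sub_distrib, Finset.mul_sum, ← Finset.sum_sub_distrib]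
  exact v.map_le_sum fun j _ => hterm j

theorem coe_le_map_sub (S : HasSingleBreak p K v π b) (hpK : p ∣ finrank K N) (hb : 1 ≤ b)
    {τ : Gal(N/K)} (hτ : τ ≠ 1) {x : N} {m : ℤ} (hx : v x = m) :
    ((m + b : ℤ) : WithTop ℤ) ≤ v (τ x - x) := by
  have h1 := S.coe_le_map_sub_sub hpK hb hτ hx
  have h2 := coe_add_le_mul (coe_add_le_mul (zero_le_map_intCast v m) (S.map_quot hτ).ge) hx.ge
  have h3 := v.map_le_add (coe_le_mono h1 (by omega : m + b ≤ _)) (coe_le_mono h2 (by omega))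
  rwa [sub_add_cancel] at h3

end HasSingleBreak

end LocalNormalBasis

/-! ### The break is prime to `p`. -/

namespace LocalNormalBasis

open Module

theorem sum_range_succ_eq_add {M : Type*} [AddCommMonoid M] {p : ℕ} (hp : 2 ≤ p) (f : ℕ → M) :
    ∑ k ∈ Finset.range (p + 1), f k =
      ∑ k ∈ Finset.range (p - 2), f (k + 2) + f 1 + f 0 + f p := by
  obtain ⟨r, rfl⟩ := Nat.exists_eq_add_of_le' hp
  rw [Finset.sum_range_succ, Finset.sum_range_succ', Finset.sum_range_succ']
  rfl

namespace HasSingleBreak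

variable {p : ℕ} {K N : Type*} [Field K] [Field N] [Algebra K N] [FiniteDimensional K N]
  {v : AddValuation N (WithTop ℤ)} {π : N} {b : ℤ}

/-- If `p ∣ b` then `(τ - 1) ^ k` acts on `π` to first order as multiplication by `u ^ k`. -/
theorem coe_le_map_pow_sub (S : HasSingleBreak p K v π b) (hpK : p ∣ finrank K N) (hb : 1 ≤ b)
    (hpb : (p : ℤ) ∣ b) {τ : Gal(N/K)} (hτ : τ ≠ 1) (k : ℕ) :
    ((k * b + 2 : ℤ) : WithTop ℤ) ≤
      v ((((τ.toLinearMap : Module.End K N) - 1) ^ k) π - ((τ π - π) / π) ^ k * π) := by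
  have hvu := S.map_quot hτ
  set s : Module.End K N := τ.toLinearMap - 1 with hs
  have hsx : ∀ x, s x = τ x - x := fun x => rfl
  generalize hu : (τ π - π) / π = u at *
  have hvk : ∀ k : ℕ, v (u ^ k * π) = ((k * b + 1 : ℤ) : WithTop ℤ) := fun k =>
    map_mul_eq_coe (map_pow_eq_coe hvu k) S.map_uniformizer
  induction k with
  | zero => simp [v.map_zero]
  | succ k ih =>
    have hy : v ((s ^ k) π) = ((k * b + 1 : ℤ) : WithTop ℤ) :=
      map_eq_of_coe_le_sub (hvk k) (coe_le_mono ih (by omega))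
    -- On an element of value `k * b + 1`, `τ - 1` acts to first order as `(k * b + 1) * u`. Since
    -- `p ∣ b`, the coefficient is `1` modulo `p`.
    have h1 : (s ^ (k + 1)) π - u ^ (k + 1) * π =
        (τ ((s ^ k) π) - (s ^ k) π - ((k * b + 1 : ℤ) : N) * u * (s ^ k) π) +
          (((k * b : ℤ) : N) * (u * (s ^ k) π) + u * ((s ^ k) π - u ^ k * π)) := by
      rw [pow_succ', Module.End.mul_apply, hsx]
      push_cast
      ring
    have h2 := S.coe_le_map_sub_sub hpK hb hτ hy
    rw [hu] at h2
    rw [h1]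
    have hcast : ((k + 1 : ℕ) : ℤ) * b + 2 = k * b + b + 2 := by push_cast; ring
    rw [hcast]
    refine v.map_le_add (coe_le_mono h2 (by omega)) (v.map_le_add ?_ ?_)
    · exact coe_le_mono (coe_add_le_mul
        (one_le_map_intCast_of_dvd S.map_prime (hpb.mul_left _)) (coe_add_le_mul hvu.ge hy.ge))
        (by omega)
    · exact coe_le_mono (coe_add_le_mul hvu.ge ih) (by omega)

/-- In the binomial expansion of `(1 + s) ^ p = 1` at `π`, with `s = τ - 1`, only the terms `k = 1`
and `k = p` matter: the middle ones carry a factor `p` and at least two factors `s`. So `p * u * π`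
and `u ^ p * π` must cancel to first order. -/
theorem coe_le_map_pow_add_prime [Fact p.Prime] (S : HasSingleBreak p K v π b)
    (hpK : p ∣ finrank K N) (hb : 1 ≤ b) (hpb : (p : ℤ) ∣ b) {e : ℤ} (he : v (p : N) = e)
    {τ : Gal(N/K)} (hτ : τ ≠ 1) (hτp : τ ^ p = 1) :
    p * b = e + b ∧ ((e + 1 : ℤ) : WithTop ℤ) ≤ v (((τ π - π) / π) ^ (p - 1) + p) := by
  have hp2 : 2 ≤ p := (Fact.out : p.Prime).two_le
  have hvu := S.map_quot hτ
  have hapx := S.coe_le_map_pow_sub hpK hb hpb hτ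
  set s : Module.End K N := τ.toLinearMap - 1 with hs
  generalize hu : (τ π - π) / π = u at *
  have hvk : ∀ k : ℕ, v (u ^ k * π) = ((k * b + 1 : ℤ) : WithTop ℤ) := fun k =>
    map_mul_eq_coe (map_pow_eq_coe hvu k) S.map_uniformizer
  have hsk : ∀ k : ℕ, v ((s ^ k) π) = ((k * b + 1 : ℤ) : WithTop ℤ) := fun k =>
    map_eq_of_coe_le_sub (hvk k) (coe_le_mono (hapx k) (by omega))
  have he1 : 1 ≤ e := le_of_coe_le he S.map_prime
  have hT : (s + 1) ^ p = 1 := by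
    have h1 : s + 1 = τ.toLinearMap := by rw [hs, sub_add_cancel]
    have h2 : ∀ k : ℕ, ∀ x, ((τ.toLinearMap : Module.End K N) ^ k) x = (τ ^ k) x := by
      intro k
      induction k with
      | zero => intro x; rfl
      | succ k ih => intro x; rw [pow_succ', pow_succ', Module.End.mul_apply, ih]; rfl
    rw [h1]
    ext x
    rw [h2, hτp]
    rfl
  set mid : N := ∑ k ∈ Finset.range (p - 2), (p.choose (k + 2) : N) * (s ^ (k + 2)) π with hmid
  have hrel : mid + p * s π + (s ^ p) π = 0 := by
    have h1 := congrArg (fun f : Module.End K N => f π) hT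
    simp only [(Commute.one_right s).add_pow, one_pow, mul_one, LinearMap.sum_apply,
      Module.End.mul_apply, Module.End.one_apply] at h1
    rw [sum_range_succ_eq_add hp2] at h1
    have h2 : ∀ (k c : ℕ), (s ^ k) ((c : Module.End K N) π) = (c : N) * (s ^ k) π := by
      intro k c
      rw [Module.End.natCast_apply, map_nsmul, nsmul_eq_mul]
    simp only [h2, Nat.choose_one_right, pow_one, Nat.choose_zero_right, Nat.cast_one,
      pow_zero, Module.End.one_apply, Nat.choose_self] at h1
    rw [← hmid] at h1
    have h3 := h2 1 p
    rw [pow_one] at h3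
    linear_combination h1 - h3
  have hvmid : ((e + b + 2 : ℤ) : WithTop ℤ) ≤ v mid := by
    refine v.map_le_sum fun k hk => ?_
    have hk' := Finset.mem_range.mp hk
    obtain ⟨c, hc⟩ := (Fact.out : p.Prime).dvd_choose_self (k := k + 2) (by omega) (by omega)
    rw [hc, Nat.cast_mul]
    refine coe_le_mono (coe_add_le_mul (coe_add_le_mul he.ge (zero_le_map_natCast v c))
      (hsk (k + 2)).ge) ?_
    push_cast
    nlinarith [mul_nonneg (Int.natCast_nonneg k) (by omega : 0 ≤ b)]
  have hw : u ^ p * π + p * (u * π) =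
      -(((s ^ p) π - u ^ p * π) + p * (s π - u * π) + mid) := by
    linear_combination hrel
  have h1 := hapx 1
  simp only [pow_one, Nat.cast_one, one_mul] at h1
  have hvpu : v (p * (u * π)) = ((e + b + 1 : ℤ) : WithTop ℤ) := by
    rw [map_mul_eq_coe he (map_mul_eq_coe hvu S.map_uniformizer)]
    congr 1
    ring
  have hvw : ∀ g : ℤ, g ≤ p * b + 2 → g ≤ e + b + 2 →
      (g : WithTop ℤ) ≤ v (u ^ p * π + p * (u * π)) := by
    intro g hg1 hg2
    rw [hw, v.map_neg]
    refine v.map_le_add (v.map_le_add (coe_le_mono (hapx p) hg1) ?_) (coe_le_mono hvmid hg2)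
    exact coe_le_mono (coe_add_le_mul he.ge h1) (by omega)
  -- With unequal values no cancellation could occur, and the sum would have the smaller of the two
  -- values, contradicting `hvw`.
  have heq : p * b = e + b := by
    rcases lt_trichotomy (p * b : ℤ) (e + b) with hlt | heq | hlt
    · have h2 : v (u ^ p * π + p * (u * π)) = ((p * b + 1 : ℤ) : WithTop ℤ) := by
        refine map_eq_of_coe_le_sub (hvk p) ?_
        rw [add_sub_cancel_left]
        exact coe_le_of_map_eq hvpu (by omega)
      have := le_of_coe_le h2 (hvw (p * b + 2) le_rfl (by omega))
      omega
    · exact heq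
    · have h2 : v (u ^ p * π + p * (u * π)) = ((e + b + 1 : ℤ) : WithTop ℤ) := by
        refine map_eq_of_coe_le_sub hvpu ?_
        rw [add_sub_cancel_right]
        exact coe_le_of_map_eq (hvk p) (by omega)
      have := le_of_coe_le h2 (hvw (e + b + 2) (by omega) le_rfl)
      omega
  refine ⟨heq, ?_⟩
  have h3 := coe_sub_le_div (hvw (e + b + 2) (by omega) le_rfl)
    (map_mul_eq_coe hvu S.map_uniformizer)
  have h4 : (u ^ p * π + p * (u * π)) / (u * π) = u ^ (p - 1) + p := by
    have hu0 := ne_zero_of_map_eq_coe hvu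
    have hπ0 := S.uniformizer_ne_zero
    rw [show u ^ p = u ^ (p - 1) * u by rw [← pow_succ]; congr 1; omega]
    field_simp
  rw [h4] at h3
  exact coe_le_mono h3 (by omega)

/-- To first order the displacement of `π` is additive in the automorphism, because `τ - 1` moves `τ
π - π` only at higher order when `b ≥ 1`. -/
theorem coe_le_map_pow_gal_sub (S : HasSingleBreak p K v π b) (hpK : p ∣ finrank K N) (hb : 1 ≤ b)
    {τ : Gal(N/K)} (hτ : τ ≠ 1) (k : ℕ) :
    ((b + 2 : ℤ) : WithTop ℤ) ≤ v ((τ ^ k) π - π - k * ((τ π - π) / π * π)) := by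
  have hπ0 := S.uniformizer_ne_zero
  rw [div_mul_cancel₀ _ hπ0]
  induction k with
  | zero => simp [v.map_zero]
  | succ k ih =>
    have h1 : (τ ^ (k + 1)) π - π - (k + 1 : ℕ) * (τ π - π) =
        τ ((τ ^ k) π - π - k * (τ π - π)) + k * (τ (τ π - π) - (τ π - π)) := by
      rw [pow_succ', AlgEquiv.mul_apply]
      simp only [_root_.map_sub, _root_.map_mul, map_natCast]
      push_cast
      ring
    rw [h1]
    refine v.map_le_add (by rwa [S.map_gal]) ?_
    exact coe_le_mono (coe_add_le_mul (zero_le_map_natCast v k)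
      (S.coe_le_map_sub hpK hb hτ (S.map_sub τ hτ))) (by omega)

/-- A single break of a noncyclic extension of exponent `p` is prime to `p`. -/
theorem not_dvd_break [Fact p.Prime] [CharZero N] (S : HasSingleBreak p K v π b)
    (hpK : p ∣ finrank K N) {σ τ : Gal(N/K)} (hσp : σ ^ p = 1)
    (hτ : τ ≠ 1) (hτp : τ ^ p = 1) (hστ : ∀ j : ℕ, σ ≠ τ ^ j) : ¬ (p : ℤ) ∣ b := by
  intro hpb
  have hb := S.one_le_break hτ hτp
  have hσ : σ ≠ 1 := by simpa using hστ 0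
  have hp1 : 1 ≤ p := (Fact.out : p.Prime).one_le
  obtain ⟨e, he⟩ := exists_map_eq_coe v (x := (p : N))
    (Nat.cast_ne_zero.mpr (Fact.out : p.Prime).ne_zero)
  obtain ⟨heb, h1⟩ := S.coe_le_map_pow_add_prime hpK hb hpb he hσ hσp
  obtain ⟨-, h2⟩ := S.coe_le_map_pow_add_prime hpK hb hpb he hτ hτp
  have hvσ := S.map_quot hσ
  have hvτ := S.map_quot hτ
  have h3 := S.coe_le_map_pow_gal_sub hpK hb hτ
  have hπ0 := S.uniformizer_ne_zero
  have hσπ : σ π - π = (σ π - π) / π * π := by rw [div_mul_cancel₀ _ hπ0]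
  generalize hs : (σ π - π) / π = s at *
  generalize ht : (τ π - π) / π = t at *
  have ht0 := ne_zero_of_map_eq_coe hvτ
  have hr : v (s / t) = ((0 : ℤ) : WithTop ℤ) := by
    rw [map_div_eq_coe hvσ hvτ, sub_self]
  have hrp : ((1 : ℤ) : WithTop ℤ) ≤ v ((s / t) ^ p - s / t) := by
    -- Both `s ^ (p - 1)` and `t ^ (p - 1)` agree with `-p` up to value `e + 1`, and `t ^ (p - 1)`
    -- has value `(p - 1) * b = e`; so the quotient gains `1`.
    have h4 : (s / t) ^ p - s / t =
        s / t * (((s ^ (p - 1) + p) - (t ^ (p - 1) + p)) / t ^ (p - 1)) := by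
      have : (s / t) ^ p = (s / t) ^ (p - 1) * (s / t) := by
        rw [← pow_succ]; congr 1; omega
      rw [this, div_pow]
      field_simp
      ring
    rw [h4]
    refine coe_le_mono (coe_add_le_mul hr.ge
      (coe_sub_le_div (v.map_le_sub h1 h2) (map_pow_eq_coe hvτ (p - 1)))) ?_
    rw [Nat.cast_sub hp1]
    push_cast
    linarith
  obtain ⟨j, hj⟩ := exists_natCast_of_pow_sub S.map_prime hr.ge hrp
  have h5 : ((b + 2 : ℤ) : WithTop ℤ) ≤ v (σ π - (τ ^ j) π) := by
    have h6 : σ π - (τ ^ j) π =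
        (s / t - j) * t * π - ((τ ^ j) π - π - j * (t * π)) := by
      have : (s / t - j) * t * π = s * π - j * (t * π) := by field_simp
      rw [this, ← hσπ]
      ring
    rw [h6]
    refine v.map_le_sub (coe_le_mono (coe_add_le_mul (coe_add_le_mul hj hvτ.ge)
      S.map_uniformizer.ge) (by omega)) (h3 j)
  have hne : (τ ^ j)⁻¹ * σ ≠ 1 := fun h => hστ j (inv_mul_eq_one.mp h).symm
  have h7 : v (((τ ^ j)⁻¹ * σ) π - π) = v (σ π - (τ ^ j) π) := by
    rw [← S.map_gal (τ ^ j), _root_.map_sub, ← AlgEquiv.mul_apply, mul_inv_cancel_left]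
  rw [← h7] at h5
  have := le_of_coe_le (S.map_sub _ hne) h5
  omega

end HasSingleBreak

end LocalNormalBasis

/-! ### Trace and norm to the fixed field of a subgroup. -/

namespace LocalNormalBasis

open Module

theorem map_prod_eq_coe {N : Type*} [Field N] {v : AddValuation N (WithTop ℤ)} {ι : Type*}
    (s : Finset ι) {f : ι → N} {c : ℤ} (h : ∀ i ∈ s, v (f i) = c) :
    v (∏ i ∈ s, f i) = ((s.card * c : ℤ) : WithTop ℤ) := by
  induction s using Finset.cons_induction with
  | empty => simp [v.map_one]
  | cons a s ha ih =>
    rw [Finset.prod_cons, map_mul_eq_coe (h a (by simp)) (ih fun i hi => h i (by simp [hi])),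
      Finset.card_cons]
    congr 1
    push_cast
    ring

namespace HasSingleBreak

variable {p : ℕ} {K N : Type*} [Field K] [Field N] [Algebra K N]
  {v : AddValuation N (WithTop ℤ)} {π : N} {b : ℤ}

theorem gal_injective (S : HasSingleBreak p K v π b) :
    Function.Injective fun σ : Gal(N/K) => σ π := by
  intro σ τ h
  by_contra hne
  have h1 : τ⁻¹ * σ ≠ 1 := fun h => hne (inv_mul_eq_one.mp h).symm
  have h2 := S.map_sub _ h1
  have h3 : (τ⁻¹ * σ) π = π := by
    rw [AlgEquiv.mul_apply, show σ π = τ π from h, ← AlgEquiv.mul_apply, inv_mul_cancel,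
      AlgEquiv.one_apply]
  rw [h3, sub_self] at h2
  exact ne_zero_of_map_eq_coe h2 rfl

theorem map_gal_sub_gal (S : HasSingleBreak p K v π b) {σ τ : Gal(N/K)} (h : σ ≠ τ) :
    v (σ π - τ π) = ((b + 1 : ℤ) : WithTop ℤ) := by
  have h1 : τ⁻¹ * σ ≠ 1 := fun h' => h (inv_mul_eq_one.mp h').symm
  rw [← S.map_sub _ h1, ← S.map_gal τ ((τ⁻¹ * σ) π - π), _root_.map_sub τ, ← AlgEquiv.mul_apply,
    mul_inv_cancel_left]

variable [FiniteDimensional K N] {q : ℕ} {H : Subgroup Gal(N/K)}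

open Classical in
theorem map_prod_subgroup (S : HasSingleBreak p K v π b) (hq : Nat.card H = q) :
    v (∏ h : H, (h : Gal(N/K)) π) = ((q : ℤ) : WithTop ℤ) := by
  rw [map_prod_eq_coe Finset.univ (c := 1) (fun h _ => by rw [S.map_gal, S.map_uniformizer]),
    Finset.card_univ, ← Nat.card_eq_fintype_card, hq, mul_one]

open Classical in
theorem gal_sum_subgroup {h : Gal(N/K)} (hh : h ∈ H) (x : N) :
    h (∑ j : H, (j : Gal(N/K)) x) = ∑ j : H, (j : Gal(N/K)) x := by
  rw [map_sum]
  exact Fintype.sum_equiv (Equiv.mulLeft (⟨h, hh⟩ : H)) _ _ fun j => rfl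

open Classical in
theorem gal_prod_subgroup {h : Gal(N/K)} (hh : h ∈ H) (x : N) :
    h (∏ j : H, (j : Gal(N/K)) x) = ∏ j : H, (j : Gal(N/K)) x := by
  rw [map_prod]
  exact Fintype.prod_equiv (Equiv.mulLeft (⟨h, hh⟩ : H)) _ _ fun j => rfl

variable [IsGalois K N]

/-- The values of the fixed field of `H` are multiples of the order of `H`. -/
theorem map_fixedField (S : HasSingleBreak p K v π b) (hq : Nat.card H = q)
    (a : IntermediateField.fixedField H) (ha : a ≠ 0) :
    ∃ t : ℤ, v (algebraMap (IntermediateField.fixedField H) N a) = ((q * t : ℤ) : WithTop ℤ) := by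
  have ha' : algebraMap (IntermediateField.fixedField H) N a ≠ 0 := by simpa using ha
  obtain ⟨c, hc⟩ := exists_map_eq_coe v ha'
  have h0 : Algebra.norm K a ≠ 0 := Algebra.norm_ne_zero_iff.mpr ha
  obtain ⟨t, ht⟩ := S.map_base _ h0
  -- The norm from `N` to `K` is computed twice: all conjugates have value `c`, and by transitivity
  -- it is the `q`-th power of the norm from the fixed field.
  have h1 := Algebra.norm_eq_prod_automorphisms K (algebraMap (IntermediateField.fixedField H) N a)
  rw [← Algebra.norm_norm (S := IntermediateField.fixedField H), Algebra.norm_algebraMap,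
    map_pow, map_pow, IntermediateField.finrank_fixedField_eq_card, hq] at h1
  have h2 := map_pow_eq_coe ht q
  rw [h1, map_prod_eq_coe Finset.univ (c := c) (fun σ _ => by rw [S.map_gal, hc]),
    Finset.card_univ, ← Nat.card_eq_fintype_card, IsGalois.card_aut_eq_finrank] at h2
  have h3 : (finrank K N : ℤ) * c = q * (finrank K N * t) := by exact_mod_cast h2
  have h4 : (finrank K N : ℤ) ≠ 0 := by exact_mod_cast (finrank_pos (R := K) (M := N)).ne'
  refine ⟨t, ?_⟩
  rw [hc]
  congr 1
  exact mul_left_cancel₀ h4 (by linear_combination h3)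

open Classical in
/-- The trace to the fixed field of `H` of an element whose valuation is congruent to `b`. -/
theorem map_sum_subgroup (S : HasSingleBreak p K v π b) (hq : Nat.card H = q) {ρ : N} {c : ℤ}
    (hρ : v ρ = c) (hc : c ≡ b [ZMOD q]) :
    v (∑ h : H, (h : Gal(N/K)) ρ) = ((c + (q - 1) * b : ℤ) : WithTop ℤ) := by
  set F := IntermediateField.fixedField H with hF
  have hcard : Fintype.card H = q := by rw [← Nat.card_eq_fintype_card, hq]
  have hq1 : 1 ≤ q := by rw [← hcard]; exact Fintype.card_pos
  -- `Φ` is the derivative at `π` of the polynomial with roots `h π`. In Euler's formula, the trace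
  -- of `y / Φ` is the coefficient of `π ^ (q - 1)` in the expansion of `y` over `F`; it is used
  -- with `y = ρ * Φ`.
  set Φ : N := ∏ h ∈ (Finset.univ : Finset H).erase 1, (π - (h : Gal(N/K)) π) with hΦ
  have hvΦ : v Φ = (((q - 1 : ℕ) * (b + 1) : ℤ) : WithTop ℤ) := by
    rw [hΦ, map_prod_eq_coe _ (c := b + 1), Finset.card_erase_of_mem (Finset.mem_univ _),
      Finset.card_univ, hcard]
    intro h hh
    have h1 : (1 : Gal(N/K)) ≠ h := fun h' => (Finset.mem_erase.mp hh).1 (Subtype.ext h'.symm)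
    exact S.map_gal_sub_gal h1
  have hΦ0 : Φ ≠ 0 := ne_zero_of_map_eq_coe hvΦ
  have hx := map_mul_eq_coe hρ hvΦ
  obtain ⟨a, i, hxe, hi, himod, -⟩ := exists_expansion (F := F) (W := ⊤) (ι := Fin q)
    (e := fun j => π ^ (j : ℕ)) (k := fun j : Fin q => (j : ℤ)) (S.map_fixedField hq)
    (fun j => by simpa using map_pow_eq_coe S.map_uniformizer (j : ℕ))
    (fun j k h => fin_eq_of_modEq h)
    (by rw [finrank_top, IntermediateField.finrank_fixedField_eq_card, hq, Fintype.card_fin])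
    (fun _ => Submodule.mem_top) Submodule.mem_top hx
  -- The leading index is exactly the one picked out by the trace: `c + (q - 1) * (b + 1)` is
  -- congruent to `-1` modulo `q` because `c ≡ b`.
  have hilast : (i : ℕ) = q - 1 := by
    have h1 : ((i : ℕ) : ℤ) ≡ ((q - 1 : ℕ) : ℤ) [ZMOD q] := by
      refine himod.trans (Int.modEq_iff_dvd.mpr ?_)
      obtain ⟨t, ht⟩ := hc.dvd
      refine ⟨t - b, ?_⟩
      rw [Nat.cast_sub hq1]
      push_cast
      linear_combination ht
    have := fin_eq_of_modEq (D := q) (i := i) (j := ⟨q - 1, by omega⟩) h1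
    rw [this]
  set P : Polynomial N := ∑ j : Fin q, Polynomial.C (algebraMap F N (a j)) *
    Polynomial.X ^ (j : ℕ) with hP
  have hdeg : P.degree < (Finset.univ : Finset H).card := by
    rw [Finset.card_univ, hcard]
    exact Polynomial.degree_sum_fin_lt _
  have hcoeff : P.coeff (q - 1) = algebraMap F N (a i) := by
    rw [hP, Polynomial.finsetSum_coeff, Finset.sum_eq_single i]
    · simp [hilast]
    · intro j _ hj
      rw [Polynomial.coeff_C_mul_X_pow, if_neg]
      intro h
      exact hj (Fin.ext (by omega))
    · simp
  have heval : ∀ h : H, P.eval ((h : Gal(N/K)) π) = (h : Gal(N/K)) (ρ * Φ) := by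
    intro h
    rw [hxe, hP, Polynomial.eval_finsetSum, map_sum]
    refine Finset.sum_congr rfl fun j _ => ?_
    have hfix : (h : Gal(N/K)) (algebraMap F N (a j)) = algebraMap F N (a j) :=
      (IntermediateField.mem_fixedField_iff H _).mp (a j).2 h h.2
    rw [Algebra.smul_def, _root_.map_mul, hfix, map_pow]
    simp
  have hprod : ∀ h : H, (h : Gal(N/K)) Φ =
      ∏ j ∈ (Finset.univ : Finset H).erase h, ((h : Gal(N/K)) π - (j : Gal(N/K)) π) := by
    intro h
    rw [hΦ, map_prod]
    refine Finset.prod_bij (fun j _ => h * j) ?_ ?_ ?_ ?_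
    · intro j hj
      simpa using (Finset.mem_erase.mp hj).1
    · intro j _ j' _ hjj
      exact mul_left_cancel hjj
    · intro j hj
      refine ⟨h⁻¹ * j, ?_, mul_inv_cancel_left _ _⟩
      simp only [Finset.mem_erase, Finset.mem_univ, and_true] at hj ⊢
      exact fun h' => hj (inv_mul_eq_one.mp h').symm
    · intro j _
      simp
  have hinj : Set.InjOn (fun h : H => (h : Gal(N/K)) π) (Finset.univ : Finset H) :=
    fun h _ h' _ hh => Subtype.ext (S.gal_injective hh)
  -- Euler's formula is Lagrange interpolation of `P` at the nodes `h π`, read off in top degree.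
  have hlag := Lagrange.coeff_eq_sum hinj hdeg
  rw [Finset.card_univ, hcard, hcoeff] at hlag
  have htr : ∑ h : H, (h : Gal(N/K)) ρ = algebraMap F N (a i) := by
    rw [hlag]
    refine Finset.sum_congr rfl fun h _ => ?_
    rw [heval, ← hprod, _root_.map_mul, mul_div_cancel_right₀]
    simpa using hΦ0
  rw [htr]
  have h1 := map_div_eq_coe hi (map_pow_eq_coe S.map_uniformizer (i : ℕ))
  rw [Algebra.smul_def, mul_div_cancel_right₀ _ (pow_ne_zero _ S.uniformizer_ne_zero)] at h1
  rw [h1, hilast, Nat.cast_sub hq1]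
  congr 1
  push_cast
  ring

open Classical in
-- The norm of `π` is, up to sign, the constant term of its polynomial `f` over the fixed field. The
-- value of `f^τ` at `π` is a product of `q` differences of value `b + 1`. Expanding it in powers of
-- `π`, the total value is divisible by `q`, so the constant term must be the leading one.
theorem map_gal_prod_subgroup_sub (S : HasSingleBreak p K v π b) (hq : Nat.card H = q)
    (hcomm : ∀ σ τ : Gal(N/K), σ * τ = τ * σ) {τ : Gal(N/K)} (hτ : τ ∉ H) :
    v (τ (∏ h : H, (h : Gal(N/K)) π) - ∏ h : H, (h : Gal(N/K)) π) =
      ((q * (b + 1) : ℤ) : WithTop ℤ) := by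
  have hcard : Fintype.card H = q := by rw [← Nat.card_eq_fintype_card, hq]
  have hq1 : 1 ≤ q := by rw [← hcard]; exact Fintype.card_pos
  set f : Polynomial N := ∏ h : H, (Polynomial.X - Polynomial.C ((h : Gal(N/K)) π)) with hf
  have hfix : ∀ h : Gal(N/K), h ∈ H → f.map (h : N →+* N) = f := by
    intro h hh
    rw [hf, Polynomial.map_prod]
    refine Fintype.prod_equiv (Equiv.mulLeft (⟨h, hh⟩ : H)) _ _ fun j => ?_
    simp
  have hfixc : ∀ h : Gal(N/K), h ∈ H → ∀ i, h (f.coeff i) = f.coeff i := by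
    intro h hh i
    conv_rhs => rw [← hfix h hh, Polynomial.coeff_map]
    rfl
  have hmonic : f.Monic := Polynomial.monic_prod_of_monic _ _ fun h _ => Polynomial.monic_X_sub_C _
  have hdeg : f.natDegree = q := by
    rw [hf, Polynomial.natDegree_finsetProd_X_sub_C_eq_card, Finset.card_univ, hcard]
  have hf0 : f.eval π = 0 := by
    rw [hf, Polynomial.eval_prod]
    exact Finset.prod_eq_zero (Finset.mem_univ 1) (by simp)
  have hfτ : (f.map (τ : N →+* N)).eval π = ∏ h : H, (π - (τ * h : Gal(N/K)) π) := by
    rw [hf, Polynomial.map_prod, Polynomial.eval_prod]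
    simp
  have hvτ : v ((f.map (τ : N →+* N)).eval π) = ((q * (b + 1) : ℤ) : WithTop ℤ) := by
    rw [hfτ, map_prod_eq_coe Finset.univ (c := b + 1), Finset.card_univ, hcard]
    intro h _
    refine S.map_gal_sub_gal (σ := 1) fun h' => hτ ?_
    rw [eq_inv_of_mul_eq_one_left h'.symm]
    exact H.inv_mem h.2
  -- Subtracting `f`, which vanishes at `π`, removes the top term. The coefficients stay in the
  -- fixed field because `G` is commutative.
  let d : Fin q → IntermediateField.fixedField H := fun i => ⟨τ (f.coeff i) - f.coeff i, by
    rw [IntermediateField.mem_fixedField_iff]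
    intro h hh
    rw [_root_.map_sub, ← AlgEquiv.mul_apply, hcomm, AlgEquiv.mul_apply, hfixc h hh]⟩
  have hsum : (f.map (τ : N →+* N)).eval π = ∑ i, d i • π ^ (i : ℕ) := by
    have h1 : (f.map (τ : N →+* N)).eval π = (f.map (τ : N →+* N)).eval π - f.eval π := by
      rw [hf0, sub_zero]
    rw [h1, Polynomial.eval_eq_sum_range, Polynomial.eval_eq_sum_range,
      hmonic.natDegree_map, hdeg, ← Finset.sum_sub_distrib, Finset.sum_range_succ]
    have h2 : f.coeff q = 1 := by rw [← hdeg]; exact hmonic.coeff_natDegree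
    rw [Polynomial.coeff_map, h2, map_one, sub_self, add_zero, Finset.sum_range]
    refine Finset.sum_congr rfl fun i _ => ?_
    rw [Polynomial.coeff_map, Algebra.smul_def, ← sub_mul]
    rfl
  have : Nonempty (Fin q) := ⟨⟨0, hq1⟩⟩
  have hπk : ∀ i : Fin q, v (π ^ (i : ℕ)) = (((i : ℕ) : ℤ) : WithTop ℤ) :=
    fun i => by simpa using map_pow_eq_coe S.map_uniformizer (i : ℕ)
  obtain ⟨i, hi, -⟩ := exists_map_sum_smul_eq (S.map_fixedField hq) hπk
    (fun j k h => fin_eq_of_modEq h) d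
  rw [← hsum, hvτ] at hi
  have hdi : d i ≠ 0 := by
    intro h
    rw [h, zero_smul, v.map_zero] at hi
    exact WithTop.coe_ne_top hi
  obtain ⟨t, ht⟩ := S.map_fixedField hq _ hdi
  rw [Algebra.smul_def] at hi
  have h3 := map_eq_unique hi.symm (map_mul_eq_coe ht (hπk i))
  have hi0 : (i : ℕ) = 0 := by
    refine Nat.eq_zero_of_dvd_of_lt ?_ i.2
    have : (q : ℤ) ∣ (i : ℕ) := ⟨b + 1 - t, by linear_combination -h3⟩
    exact_mod_cast this
  rw [hi0, pow_zero, mul_one] at hi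
  have hc0 : f.coeff 0 = (-1) ^ q * ∏ h : H, (h : Gal(N/K)) π := by
    rw [Polynomial.coeff_zero_eq_eval_zero, hf, Polynomial.eval_prod]
    simp only [Polynomial.eval_sub, Polynomial.eval_X, Polynomial.eval_C, zero_sub]
    rw [Finset.prod_neg, Finset.card_univ, hcard]
  have h4 : algebraMap (IntermediateField.fixedField H) N (d i) =
      (-1) ^ q * (τ (∏ h : H, (h : Gal(N/K)) π) - ∏ h : H, (h : Gal(N/K)) π) := by
    change τ (f.coeff i) - f.coeff i = _
    rw [hi0, hc0]
    simp only [_root_.map_mul, map_pow, map_neg, map_one]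
    ring
  rw [hi, h4]
  rcases neg_one_pow_eq_or N q with h5 | h5 <;> rw [h5]
  · rw [one_mul]
  · rw [neg_one_mul, v.map_neg]

end HasSingleBreak

end LocalNormalBasis

/-! ### Fixed fields of degree `p` over `K`. -/

namespace LocalNormalBasis

open Module

theorem mul_fin_eq_of_modEq {p q : ℕ} (hq : q ≠ 0) {i j : Fin p} {D : ℕ} (hD : D = p * q)
    (h : (q : ℤ) * (i : ℕ) ≡ q * (j : ℕ) [ZMOD D]) : i = j := by
  subst hD
  rw [Nat.cast_mul, mul_comm (p : ℤ)] at h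
  exact fin_eq_of_modEq (Int.ModEq.mul_left_cancel' (by exact_mod_cast hq) h)

namespace HasSingleBreak

variable {p : ℕ} {K N : Type*} [Field K] [Field N] [Algebra K N] [FiniteDimensional K N]
  {v : AddValuation N (WithTop ℤ)} {π : N} {b : ℤ} [IsGalois K N] {q : ℕ} {H : Subgroup Gal(N/K)}

theorem finrank_fixedField_eq (hq : Nat.card H = q) (hpq : finrank K N = p * q) :
    finrank K (Subalgebra.toSubmodule (IntermediateField.fixedField H).toSubalgebra) = p := by
  have h1 := finrank_mul_finrank K (IntermediateField.fixedField H) N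
  have hq0 : 0 < q := by rw [← hq]; exact Nat.card_pos
  rw [IntermediateField.finrank_fixedField_eq_card, hq, hpq] at h1
  exact Nat.eq_of_mul_eq_mul_right hq0 h1

/-- On the fixed field of a subgroup of index `p` the break is again `b`. -/
theorem map_gal_sub_fixedField [Fact p.Prime] (S : HasSingleBreak p K v π b)
    (hq : Nat.card H = q) (hpq : finrank K N = p * q)
    (hcomm : ∀ σ τ : Gal(N/K), σ * τ = τ * σ) (hb : 1 ≤ b) {τ : Gal(N/K)} (hτ : τ ∉ H)
    {x : N} (hxF : x ∈ IntermediateField.fixedField H) {m : ℤ}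
    (hx : v x = ((q * m : ℤ) : WithTop ℤ)) (hm : ¬ (p : ℤ) ∣ m) :
    v (τ x - x) = ((q * (m + b) : ℤ) : WithTop ℤ) := by
  classical
  have hq0 : 0 < q := by rw [← hq]; exact Nat.card_pos
  have hqb : 1 ≤ (q : ℤ) * b := by nlinarith
  have hvP := S.map_prod_subgroup hq
  have hvd := S.map_gal_prod_subgroup_sub hq hcomm hτ
  have hPF : ∏ h : H, (h : Gal(N/K)) π ∈ IntermediateField.fixedField H :=
    (IntermediateField.mem_fixedField_iff H _).mpr fun h hh => gal_prod_subgroup hh π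
  generalize ∏ h : H, (h : Gal(N/K)) π = P at *
  have hP0 := ne_zero_of_map_eq_coe hvP
  have hvu : v ((τ P - P) / P) = ((q * b : ℤ) : WithTop ℤ) := by
    rw [map_div_eq_coe hvd hvP]
    congr 1
    ring
  obtain ⟨a, i, hxe, hi, himod, hj⟩ := exists_expansion (F := K)
    (W := Subalgebra.toSubmodule (IntermediateField.fixedField H).toSubalgebra)
    (ι := Fin p) (e := fun j => P ^ (j : ℕ)) (k := fun j : Fin p => (q : ℤ) * (j : ℕ)) S.map_base
    (fun j => by rw [map_pow_eq_coe hvP, mul_comm])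
    (fun j k h => mul_fin_eq_of_modEq hq0.ne' hpq h)
    (by rw [finrank_fixedField_eq hq hpq, Fintype.card_fin])
    (fun j => pow_mem hPF _) hxF hx
  have hpi : ¬ (p : ℤ) ∣ (i : ℕ) := by
    rw [hpq, Nat.cast_mul, mul_comm (p : ℤ)] at himod
    have h1 := Int.ModEq.mul_left_cancel' (by exact_mod_cast hq0.ne') himod
    intro h2
    exact hm ((h1.dvd_iff).mp h2)
  have hterm : ∀ j : Fin p, τ (a j • P ^ (j : ℕ)) - a j • P ^ (j : ℕ) =
      a j • P ^ (j : ℕ) * ((1 + (τ P - P) / P) ^ (j : ℕ) - 1) := fun j => by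
    rw [gal_smul_pow hP0]
    ring
  generalize (τ P - P) / P = u at *
  -- The leading exponent `i` is prime to `p` like `m`, so `(1 + u) ^ i - 1` has exactly the value
  -- of `i * u`, namely that of `u`.
  have hmain : v (a i • P ^ (i : ℕ) * ((1 + u) ^ (i : ℕ) - 1)) =
      ((q * (m + b) : ℤ) : WithTop ℤ) := by
    rw [mul_add (q : ℤ)]
    refine map_mul_eq_coe hi (map_eq_of_coe_le_sub (x := (i : ℕ) * u) ?_ ?_)
    · have h1 := map_mul_eq_coe (map_intCast_of_not_dvd S.map_prime hpi) hvu
      rwa [zero_add, Int.cast_natCast] at h1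
    · exact coe_le_mono (coe_le_one_add_pow_sub (by omega) hvu.ge i) (by omega)
  refine map_eq_of_coe_le_sub hmain ?_
  have hsum : τ x - x = ∑ j, a j • P ^ (j : ℕ) * ((1 + u) ^ (j : ℕ) - 1) := by
    conv_lhs => rw [hxe, map_sum, ← Finset.sum_sub_distrib]
    exact Finset.sum_congr rfl fun j _ => hterm j
  rw [hsum, ← Finset.add_sum_erase _ _ (Finset.mem_univ i), add_sub_cancel_left]
  refine v.map_le_sum fun j hj' => ?_
  refine coe_le_mono (coe_add_le_mul (hj j (Finset.ne_of_mem_erase hj'))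
    (coe_le_one_add_pow_sub_one (by omega) hvu.ge j)) (le_of_eq ?_)
  ring

/-- A `τ`-stable subspace containing an element of the fixed field of `H`, of valuation
congruent to `b` there, contains the whole fixed field. -/
theorem mem_of_mem_fixedField [Fact p.Prime] (S : HasSingleBreak p K v π b)
    (hq : Nat.card H = q) (hpq : finrank K N = p * q)
    (hcomm : ∀ σ τ : Gal(N/K), σ * τ = τ * σ) (hb : 1 ≤ b) (hpb : ¬ (p : ℤ) ∣ b)
    {τ : Gal(N/K)} (hτ : τ ∉ H) {V : Submodule K N} (hV : ∀ x ∈ V, τ x ∈ V)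
    {θ : N} (hθV : θ ∈ V) (hθF : θ ∈ IntermediateField.fixedField H) {m : ℤ}
    (hθ : v θ = ((q * m : ℤ) : WithTop ℤ)) (hm : m ≡ b [ZMOD p])
    {x : N} (hx : x ∈ IntermediateField.fixedField H) : x ∈ V := by
  have hq0 : 0 < q := by rw [← hq]; exact Nat.card_pos
  have hpp : Prime (p : ℤ) := Nat.prime_iff_prime_int.mp Fact.out
  by_cases hx0 : x = 0
  · rw [hx0]
    exact V.zero_mem
  obtain ⟨c, hc⟩ := exists_map_eq_coe v hx0
  set s : N → N := fun y => τ y - y with hs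
  have hsV : ∀ k : ℕ, s^[k] θ ∈ V := by
    intro k
    induction k with
    | zero => exact hθV
    | succ k ih =>
      rw [Function.iterate_succ_apply']
      exact V.sub_mem (hV _ ih) ih
  have hsF : ∀ k : ℕ, s^[k] θ ∈ IntermediateField.fixedField H := by
    intro k
    induction k with
    | zero => exact hθF
    | succ k ih =>
      rw [Function.iterate_succ_apply', IntermediateField.mem_fixedField_iff]
      intro h hh
      have h1 := (IntermediateField.mem_fixedField_iff H _).mp ih h hh
      simp only [hs]
      rw [_root_.map_sub, ← AlgEquiv.mul_apply, hcomm, AlgEquiv.mul_apply]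
      simp only [hs] at h1
      rw [h1]
  have hsv : ∀ k : ℕ, k < p → v (s^[k] θ) = ((q * (m + k * b) : ℤ) : WithTop ℤ) := by
    intro k
    induction k with
    | zero => intro _; simpa using hθ
    | succ k ih =>
      intro hk
      rw [Function.iterate_succ_apply']
      -- The current normalized value is congruent to `(k + 1) * b`, which is prime to `p` as `k + 1
      -- < p`. This is where `m ≡ b` enters.
      have h1 := S.map_gal_sub_fixedField hq hpq hcomm hb hτ (hsF k) (ih (by omega)) (by
        intro h2
        have h3 : m + k * b ≡ (k + 1 : ℕ) * b [ZMOD p] := by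
          have := hm.add_right (k * b)
          push_cast
          rwa [add_mul, one_mul, add_comm _ b]
        rcases hpp.dvd_or_dvd ((h3.dvd_iff).mp h2) with h4 | h4
        · have h5 : p ≤ k + 1 := Nat.le_of_dvd (by omega) (by exact_mod_cast h4)
          omega
        · exact hpb h4)
      rw [hs]
      rw [hs] at h1
      rw [h1]
      congr 2
      push_cast
      ring
  obtain ⟨a, -, rfl, -⟩ := exists_expansion (F := K)
    (W := Subalgebra.toSubmodule (IntermediateField.fixedField H).toSubalgebra)
    (ι := Fin p) (e := fun j => s^[(j : ℕ)] θ)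
    (k := fun j : Fin p => (q : ℤ) * (m + (j : ℕ) * b)) S.map_base
    (fun j => hsv j j.2)
    (fun j k h => by
      rw [hpq, Nat.cast_mul, mul_comm (p : ℤ)] at h
      have h1 := (Int.ModEq.mul_left_cancel' (by exact_mod_cast hq0.ne') h).add_left_cancel' m
      refine fin_eq_of_modEq (Int.modEq_iff_dvd.mpr ?_)
      have h2 := h1.dvd
      rw [← sub_mul] at h2
      exact (hpp.dvd_or_dvd h2).resolve_right hpb)
    (by rw [finrank_fixedField_eq hq hpq, Fintype.card_fin])
    (fun j => hsF j) hx hc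
  exact V.sum_mem fun j _ => V.smul_mem _ (hsV j)

end HasSingleBreak

/-! ### Averaging over hyperplanes, and the normal basis. -/

section ElementaryAbelian

variable {p n : ℕ} [Fact p.Prime]

/-- By symmetry of the pairing this serves twice: for the order of a hyperplane subgroup, and for
the number of linear forms vanishing at a nontrivial element. -/
theorem card_dotProduct_eq_zero {g : Fin n → ZMod p} (hg : g ≠ 0) :
    Nat.card {l : Fin n → ZMod p // l ⬝ᵥ g = 0} * p = p ^ n := by
  let f : (Fin n → ZMod p) →+ ZMod p :=
    { toFun := fun l => l ⬝ᵥ g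
      map_zero' := zero_dotProduct g
      map_add' := fun x y => add_dotProduct x y g }
  have hsurj : Function.Surjective f := by
    intro c
    obtain ⟨j, hj⟩ := Function.ne_iff.mp hg
    refine ⟨Pi.single j (c / g j), ?_⟩
    change Pi.single j (c / g j) ⬝ᵥ g = c
    rw [single_dotProduct, div_mul_cancel₀ _ hj]
  have h1 := AddSubgroup.card_mul_index f.ker
  rw [AddSubgroup.index_ker, AddMonoidHom.range_eq_top.mpr hsurj, AddSubgroup.card_top] at h1
  rw [Nat.card_zmod, Nat.card_fun, Nat.card_zmod, Nat.card_fin] at h1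
  exact h1

variable {K N : Type*} [Field K] [Field N] [Algebra K N] [FiniteDimensional K N]

/-- A subspace containing the fixed fields of all subgroups of index `p` of an elementary abelian
Galois group is everything. -/
theorem eq_top_of_fixedField_le [CharZero K] (φ : Gal(N/K) ≃* Multiplicative (Fin n → ZMod p))
    {q : ℕ} (hn : n ≠ 0) (hq : p ^ n = p * q) {V : Submodule K N}
    (hV : ∀ H : Subgroup Gal(N/K), Nat.card H = q →
      ∀ x ∈ IntermediateField.fixedField H, x ∈ V) : V = ⊤ := by
  classical
  have hp2 : 2 ≤ p := (Fact.out : p.Prime).two_le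
  have hq0 : 0 < q := by
    rcases Nat.eq_zero_or_pos q with h | h
    · rw [h, mul_zero] at hq
      exact absurd hq (pow_ne_zero _ (by omega))
    · exact h
  let ψ : Gal(N/K) → (Fin n → ZMod p) := fun σ => (φ σ).toAdd
  have hψ1 : ψ 1 = 0 := by simp [ψ]
  have hψm : ∀ σ τ, ψ (σ * τ) = ψ σ + ψ τ := fun σ τ => by simp [ψ]
  have hψi : ∀ σ, ψ σ⁻¹ = -ψ σ := fun σ => by simp [ψ]
  have hψ : ∀ σ, σ ≠ 1 → ψ σ ≠ 0 := fun σ hσ h => hσ (φ.injective (by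
    rw [map_one]
    exact Multiplicative.toAdd.injective h))
  let H : (Fin n → ZMod p) → Subgroup Gal(N/K) := fun l =>
    { carrier := {σ | l ⬝ᵥ ψ σ = 0}
      one_mem' := by simp [hψ1]
      mul_mem' := fun {σ τ} hσ hτ => by
        simp only [Set.mem_ofPred_eq] at hσ hτ ⊢
        rw [hψm, dotProduct_add, hσ, hτ, add_zero]
      inv_mem' := fun {σ} hσ => by
        simp only [Set.mem_ofPred_eq] at hσ ⊢
        rw [hψi, dotProduct_neg, hσ, neg_zero] }
  have hHcard : ∀ l, l ≠ 0 → Nat.card (H l) = q := by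
    intro l hl
    have h1 := card_dotProduct_eq_zero hl
    have h2 : Nat.card (H l) = Nat.card {g : Fin n → ZMod p // g ⬝ᵥ l = 0} :=
      Nat.card_congr ((φ.toEquiv.trans Multiplicative.toAdd).subtypeEquiv fun σ => by
        rw [dotProduct_comm]
        rfl)
    rw [h2]
    rw [hq, mul_comm] at h1
    exact Nat.eq_of_mul_eq_mul_left (by omega) h1
  have hcount : ∀ σ, σ ≠ 1 →
      (Finset.univ.filter fun l : Fin n → ZMod p => l ⬝ᵥ ψ σ = 0).card = q := by
    intro σ hσ
    have h1 := card_dotProduct_eq_zero (hψ σ hσ)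
    rw [Nat.card_eq_fintype_card, Fintype.card_subtype, hq, mul_comm] at h1
    exact Nat.eq_of_mul_eq_mul_left (by omega) h1
  rw [eq_top_iff]
  intro z _
  -- `T l` is the trace of `z` to the fixed field of `H l`; for `l = 0` it is the full trace, which
  -- lies in every fixed field.
  let T : (Fin n → ZMod p) → N := fun l => ∑ σ ∈ Finset.univ.filter (fun σ => l ⬝ᵥ ψ σ = 0), σ z
  have hTfix : ∀ l, ∀ h ∈ H l, h (T l) = T l := by
    intro l h hh
    have h1 : T l = ∑ j : H l, (j : Gal(N/K)) z :=
      Finset.sum_subtype _ (fun σ => by simp only [Finset.mem_filter_univ]; rfl) _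
    rw [h1]
    exact HasSingleBreak.gal_sum_subgroup hh z
  have hone : (1 : Fin n → ZMod p) ≠ 0 := by
    have : Nonempty (Fin n) := ⟨⟨0, Nat.pos_of_ne_zero hn⟩⟩
    exact one_ne_zero
  have hT0 : T 0 = ∑ σ : Gal(N/K), σ z := by simp [T]
  have hT0V : T 0 ∈ V := hV (H 1) (hHcard 1 hone) _
    ((IntermediateField.mem_fixedField_iff _ _).mpr fun h _ => hTfix 0 h (zero_dotProduct _))
  have hTV : ∀ l, T l ∈ V := by
    intro l
    by_cases hl : l = 0
    · rw [hl]
      exact hT0V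
    · exact hV (H l) (hHcard l hl) _
        ((IntermediateField.mem_fixedField_iff _ _).mpr fun h hh => hTfix l h hh)
  -- In the double sum the identity is counted `p ^ n` times and every other element `q` times. In
  -- characteristic `0` this can be solved for `z`.
  have hsum : ∑ l, T l = ((p ^ n : ℕ) - q : N) * z + q * T 0 := by
    have h1 : ∑ l, T l = ∑ σ : Gal(N/K),
        ((Finset.univ.filter fun l : Fin n → ZMod p => l ⬝ᵥ ψ σ = 0).card : N) * σ z := by
      simp only [T, Finset.sum_filter]
      rw [Finset.sum_comm]
      refine Finset.sum_congr rfl fun σ _ => ?_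
      rw [← Finset.sum_filter, Finset.sum_const, nsmul_eq_mul]
    rw [h1, hT0, ← Finset.add_sum_erase _ _ (Finset.mem_univ 1),
      ← Finset.add_sum_erase _ (fun σ : Gal(N/K) => σ z) (Finset.mem_univ 1), mul_add,
      Finset.mul_sum]
    have h2 : (Finset.univ.filter fun l : Fin n → ZMod p => l ⬝ᵥ ψ 1 = 0).card = p ^ n := by
      simp [hψ1]
    rw [h2, Finset.sum_congr rfl fun σ hσ => by rw [hcount σ (Finset.ne_of_mem_erase hσ)]]
    simp only [AlgEquiv.one_apply]
    ring
  have hc : ((p ^ n : ℕ) - q : K) ≠ 0 := by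
    rw [hq, sub_ne_zero]
    intro h
    have h1 : p * q = q := by exact_mod_cast h
    nlinarith
  rw [← V.smul_mem_iff hc]
  have h1 : ((p ^ n : ℕ) - q : K) • z = ∑ l, T l - (q : K) • T 0 := by
    rw [hsum, Algebra.smul_def, Algebra.smul_def]
    simp
  rw [h1]
  exact V.sub_mem (V.sum_mem fun l _ => hTV l) (V.smul_mem _ hT0V)

theorem HasSingleBreak.generatesNormalBasis [IsGalois K N] [CharZero K] [CharZero N] (hn : 1 < n)
    (φ : Gal(N/K) ≃* Multiplicative (Fin n → ZMod p))
    {v : AddValuation N (WithTop ℤ)} {π : N} {b : ℤ} (S : HasSingleBreak p K v π b)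
    {ρ : N} {c : ℤ} (hρ : v ρ = c) (hc : c ≡ b [ZMOD (p : ℤ) ^ n]) :
    GeneratesNormalBasis K ρ := by
  classical
  have hp2 : 2 ≤ p := (Fact.out : p.Prime).two_le
  have hcomm : ∀ σ τ : Gal(N/K), σ * τ = τ * σ := fun σ τ => φ.injective (by
    rw [_root_.map_mul, _root_.map_mul, mul_comm])
  have hpow : ∀ σ : Gal(N/K), σ ^ p = 1 := fun σ => φ.injective (by
    rw [map_pow, map_one]
    refine Multiplicative.toAdd.injective ?_
    ext i
    simp)
  have hcard : Nat.card Gal(N/K) = p ^ n := by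
    rw [Nat.card_congr φ.toEquiv]
    simp
  have hfin : finrank K N = p ^ n := by rw [← IsGalois.card_aut_eq_finrank, hcard]
  obtain ⟨q, hq⟩ : ∃ q, p ^ n = p * q :=
    ⟨p ^ (n - 1), by rw [← pow_succ']; congr 1; omega⟩
  have hproper : ∀ H : Subgroup Gal(N/K), Nat.card H < p ^ n → ∃ τ, τ ∉ H := by
    intro H hH
    by_contra! h
    rw [(Subgroup.eq_top_iff' H).mpr h, Subgroup.card_top, hcard] at hH
    exact lt_irrefl _ hH
  obtain ⟨τ, hτ⟩ := hproper ⊥ (by rw [Subgroup.card_bot]; exact Nat.one_lt_pow (by omega) hp2)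
  rw [Subgroup.mem_bot] at hτ
  -- A cyclic subgroup has order at most `p`, which is less than `p ^ n`.
  obtain ⟨σ, hσ⟩ := hproper (Subgroup.zpowers τ) (by
    rw [Nat.card_zpowers]
    calc orderOf τ ≤ p := orderOf_le_of_pow_eq_one (by omega) (hpow τ)
      _ < p ^ n := by simpa using Nat.pow_lt_pow_right hp2 hn)
  have hpK : p ∣ finrank K N := by rw [hfin, hq]; exact dvd_mul_right _ _
  have hb := S.one_le_break hτ (hpow τ)
  have hpb : ¬ (p : ℤ) ∣ b := S.not_dvd_break hpK (hpow σ) hτ (hpow τ) fun j h =>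
    hσ (h ▸ Subgroup.npow_mem_zpowers τ j)
  have htop : Submodule.span K (Set.range fun σ : Gal(N/K) => σ ρ) = ⊤ := by
    refine eq_top_of_fixedField_le φ (by omega) hq fun H hH x hx => ?_
    have hq0 : 0 < q := by rw [← hH]; exact Nat.card_pos
    obtain ⟨τ, hτ⟩ := hproper H (by rw [hH, hq]; nlinarith)
    obtain ⟨t, ht⟩ := hc.dvd
    have hqc : (p : ℤ) ^ n = p * q := by exact_mod_cast hq
    have hstable : ∀ x ∈ Submodule.span K (Set.range fun σ : Gal(N/K) => σ ρ),
        τ x ∈ Submodule.span K (Set.range fun σ : Gal(N/K) => σ ρ) := by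
      intro x hx
      induction hx using Submodule.span_induction with
      | mem x hx =>
        obtain ⟨σ, rfl⟩ := hx
        exact Submodule.subset_span ⟨τ * σ, rfl⟩
      | zero => rw [map_zero]; exact Submodule.zero_mem _
      | add x y _ _ hx hy => rw [map_add]; exact Submodule.add_mem _ hx hy
      | smul a x _ hx => 
        rw [show τ (a • x) = a • τ x from τ.toLinearMap.map_smul a x]
        exact Submodule.smul_mem _ a hx
    -- From `b - c = p * q * t`, the trace has value `c + (q - 1) * b = q * (b - p * t)`, which
    -- dictates `m`.
    refine S.mem_of_mem_fixedField hH (hfin.trans hq) hcomm hb hpb hτ hstable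
      (θ := ∑ h : H, (h : Gal(N/K)) ρ) (m := b - p * t)
      (Submodule.sum_mem _ fun h _ => Submodule.subset_span ⟨h, rfl⟩)
      ((IntermediateField.mem_fixedField_iff H _).mpr fun h hh => gal_sum_subgroup hh ρ) ?_
      (Int.modEq_iff_dvd.mpr ⟨t, by ring⟩) hx
    rw [S.map_sum_subgroup hH hρ (hc.of_dvd ⟨p, by rw [hqc]; ring⟩)]
    congr 1
    rw [hqc] at ht
    linear_combination -ht
  exact ⟨linearIndependent_of_top_le_span_of_card_eq_finrank htop.ge (by
    rw [← Nat.card_eq_fintype_card, hcard, hfin]), htop⟩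

end ElementaryAbelian

end LocalNormalBasis

/-! ### The normalized valuation of a finite extension of `ℚ_[p]`. -/

noncomputable section

namespace LocalNormalBasis

open Module

theorem map_zpow_eq_coe {N : Type*} [Field N] {v : AddValuation N (WithTop ℤ)} {x : N} {c : ℤ}
    (hx : v x = c) (k : ℤ) : v (x ^ k) = ((k * c : ℤ) : WithTop ℤ) := by
  obtain ⟨m, rfl | rfl⟩ := k.eq_nat_or_neg
  · rw [zpow_natCast, map_pow_eq_coe hx]
  · have h := map_div_eq_coe (x := 1) (c := 0) (by simp [v.map_one]) (map_pow_eq_coe hx m)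
    rw [zpow_neg, zpow_natCast, ← one_div, h]
    congr 1
    ring

/-- After division by `ϖ ^ k` the element and its inverse are both integral, hence so are their
images: units go to value `0`, and only the image of `ϖ` matters. Used for automorphisms of `N` and
for the embedding of `K`. -/
theorem map_ringHom_eq_mul {L N : Type*} [Field L] [Field N] {v : AddValuation L (WithTop ℤ)}
    {w : AddValuation N (WithTop ℤ)} (f : L →+* N)
    (h : ∀ x, ((0 : ℤ) : WithTop ℤ) ≤ v x → ((0 : ℤ) : WithTop ℤ) ≤ w (f x))
    {ϖ : L} (hϖ : v ϖ = ((1 : ℤ) : WithTop ℤ)) {d : ℤ} (hd : w (f ϖ) = d)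
    {x : L} {k : ℤ} (hx : v x = k) : w (f x) = ((d * k : ℤ) : WithTop ℤ) := by
  have hϖ0 := ne_zero_of_map_eq_coe hϖ
  have hpk : v (ϖ ^ k) = (k : WithTop ℤ) := by simpa using map_zpow_eq_coe hϖ k
  have hy0 : x / ϖ ^ k ≠ 0 := div_ne_zero (ne_zero_of_map_eq_coe hx) (zpow_ne_zero _ hϖ0)
  have h1 := h (x / ϖ ^ k) (by rw [map_div_eq_coe hx hpk, sub_self])
  have h2 := h (ϖ ^ k / x) (by rw [map_div_eq_coe hpk hx, sub_self])
  obtain ⟨e, he⟩ := exists_map_eq_coe w (x := f (x / ϖ ^ k))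
    ((map_ne_zero f).mpr hy0)
  have h3 := map_div_eq_coe (x := 1) (c := 0) (by simp [w.map_one]) he
  rw [← map_one f, ← map_div₀, one_div_div] at h3
  have he0 : e = 0 := by linarith [le_of_coe_le he h1, le_of_coe_le h3 h2]
  have h4 := map_mul_eq_coe he (map_zpow_eq_coe hd k)
  rw [← map_zpow₀, ← map_mul, div_mul_cancel₀ _ (zpow_ne_zero _ hϖ0)] at h4
  rw [h4, he0]
  congr 1
  ring

section Val

variable (p : ℕ) [Fact p.Prime] (N : Type*) [Field N] [Algebra ℚ_[p] N] [FiniteDimensional ℚ_[p] N]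

variable {N} in
theorem val_of_ne_zero {x : N} (hx : x ≠ 0) : val p N x =
    ((-WithZero.log ((IsDiscreteValuationRing.maximalIdeal (integers p N)).valuation N x) : ℤ) :
      WithTop ℤ) := by
  rw [val, if_neg hx]

variable {N} in
theorem val_add (x y : N) : min (val p N x) (val p N y) ≤ val p N (x + y) := by
  by_cases hx : x = 0
  · simp [hx]
  by_cases hy : y = 0
  · simp [hy]
  by_cases hxy : x + y = 0
  · simp [hxy, val]
  rw [val_of_ne_zero p hx, val_of_ne_zero p hy, val_of_ne_zero p hxy]
  have hV := (IsDiscreteValuationRing.maximalIdeal (integers p N)).valuation N |>.map_add x y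
  set V := (IsDiscreteValuationRing.maximalIdeal (integers p N)).valuation N
  have h0 : ∀ z : N, z ≠ 0 → V z ≠ 0 := fun z hz => (Valuation.ne_zero_iff V).mpr hz
  rcases le_max_iff.mp hV with h | h
  · refine min_le_of_left_le (WithTop.coe_le_coe.mpr (neg_le_neg ?_))
    exact (WithZero.log_le_log (h0 _ hxy) (h0 _ hx)).mpr h
  · refine min_le_of_right_le (WithTop.coe_le_coe.mpr (neg_le_neg ?_))
    exact (WithZero.log_le_log (h0 _ hxy) (h0 _ hy)).mpr h

variable {N} in
theorem val_mul (x y : N) : val p N (x * y) = val p N x + val p N y := by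
  by_cases hx : x = 0
  · simp [hx, val]
  by_cases hy : y = 0
  · simp [hy, val]
  have h0 : ∀ z : N, z ≠ 0 →
      (IsDiscreteValuationRing.maximalIdeal (integers p N)).valuation N z ≠ 0 :=
    fun z hz => (Valuation.ne_zero_iff _).mpr hz
  rw [val_of_ne_zero p hx, val_of_ne_zero p hy, val_of_ne_zero p (mul_ne_zero hx hy), map_mul,
    WithZero.log_mul (h0 _ hx) (h0 _ hy), neg_add, WithTop.coe_add]

/-- `val p N` as an additive valuation. -/
def addVal : AddValuation N (WithTop ℤ) :=
  AddValuation.of (val p N) (by simp [val]) (by simp [val]) (val_add p) (val_mul p)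

variable {N} in
theorem addVal_apply (x : N) : addVal p N x = val p N x := rfl

variable {N} in
theorem zero_le_addVal_iff (x : N) :
    ((0 : ℤ) : WithTop ℤ) ≤ addVal p N x ↔ IsIntegral ℤ_[p] x := by
  rw [addVal_apply]
  by_cases hx : x = 0
  · simp [hx, val, isIntegral_zero]
  have h0 : (IsDiscreteValuationRing.maximalIdeal (integers p N)).valuation N x ≠ 0 :=
    (Valuation.ne_zero_iff _).mpr hx
  rw [val_of_ne_zero p hx, WithTop.coe_le_coe, neg_nonneg, WithZero.log_le_iff_le_exp h0,
    WithZero.exp_zero]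
  constructor
  · intro h
    obtain ⟨y, rfl⟩ := IsDedekindDomain.HeightOneSpectrum.mem_integers_of_valuation_le_one
      (R := integers p N) N x fun w => by
        have hw : w = IsDiscreteValuationRing.maximalIdeal (integers p N) :=
          IsDedekindDomain.HeightOneSpectrum.ext (IsLocalRing.eq_maximalIdeal
            (Ideal.IsPrime.isMaximal w.isPrime w.ne_bot))
        rw [hw]
        exact h
    exact y.2
  · intro h
    exact IsDedekindDomain.HeightOneSpectrum.valuation_le_one _ (⟨x, h⟩ : integers p N)

theorem exists_addVal_eq_one : ∃ ϖ : N, addVal p N ϖ = ((1 : ℤ) : WithTop ℤ) := by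
  obtain ⟨ϖ, h⟩ := (IsDiscreteValuationRing.maximalIdeal
    (integers p N)).valuation_exists_uniformizer N
  have h0 : ϖ ≠ 0 := by
    rintro rfl
    rw [map_zero] at h
    exact WithZero.exp_ne_zero h.symm
  refine ⟨ϖ, ?_⟩
  rw [addVal_apply, val_of_ne_zero p h0, h]
  simp

theorem one_le_addVal_prime : ((1 : ℤ) : WithTop ℤ) ≤ addVal p N (p : N) := by
  have : CharZero N := charZero_of_injective_algebraMap (algebraMap ℚ_[p] N).injective
  have hp0 : (p : N) ≠ 0 := Nat.cast_ne_zero.mpr (Fact.out : p.Prime).ne_zero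
  obtain ⟨e, he⟩ := exists_map_eq_coe (addVal p N) hp0
  refine coe_le_of_map_eq he ?_
  by_contra hlt
  have h1 := map_div_eq_coe (x := 1) (c := 0) (by simp [(addVal p N).map_one]) he
  have h2 := (zero_le_addVal_iff p _).mp (coe_le_of_map_eq h1 (by omega : (0 : ℤ) ≤ _))
  rw [isIntegral_iff_spectralNorm_le_one] at h2
  -- If the value of `p` were not positive, `1 / p` would be integral over `ℤ_[p]`; but its spectral
  -- norm is `p`.
  have h3 : (1 / p : N) = algebraMap ℚ_[p] N (p : ℚ_[p])⁻¹ := by simp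
  rw [h3, spectralNorm_extends, norm_inv, Padic.norm_p, inv_inv] at h2
  have h4 : p ≤ 1 := by exact_mod_cast h2
  have := (Fact.out : p.Prime).two_le
  omega

variable {N} in
theorem addVal_gal {K : Type*} [Field K] [Algebra ℚ_[p] K] [Algebra K N]
    [IsScalarTower ℚ_[p] K N] (σ : Gal(N/K)) (x : N) : addVal p N (σ x) = addVal p N x := by
  have hint : ∀ (σ : Gal(N/K)) (x : N), ((0 : ℤ) : WithTop ℤ) ≤ addVal p N x →
      ((0 : ℤ) : WithTop ℤ) ≤ addVal p N ((σ : N →+* N) x) := by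
    intro σ x hx
    rw [zero_le_addVal_iff] at hx ⊢
    exact hx.map (((σ : N →ₐ[K] N).restrictScalars ℚ_[p]).restrictScalars ℤ_[p])
  obtain ⟨ϖ, hϖ⟩ := exists_addVal_eq_one p N
  have hmul : ∀ σ : Gal(N/K), ∃ d : ℤ, 0 ≤ d ∧ ∀ (x : N) (k : ℤ), addVal p N x = k →
      addVal p N (σ x) = ((d * k : ℤ) : WithTop ℤ) := by
    intro σ
    obtain ⟨d, hd⟩ := exists_map_eq_coe (addVal p N) (x := (σ : N →+* N) ϖ) (by
      simpa using ne_zero_of_map_eq_coe hϖ)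
    exact ⟨d, le_of_coe_le hd (hint σ ϖ (coe_le_of_map_eq hϖ (by omega))),
      fun x k hx => map_ringHom_eq_mul (σ : N →+* N) (hint σ) hϖ hd hx⟩
  obtain ⟨d, hd0, hd⟩ := hmul σ
  obtain ⟨d', -, hd'⟩ := hmul σ⁻¹
  have h1 := hd' _ _ (hd ϖ 1 hϖ)
  rw [← AlgEquiv.mul_apply, inv_mul_cancel, AlgEquiv.one_apply] at h1
  have h2 := map_eq_unique h1 hϖ
  -- `σ` and its inverse scale values by integers with product `1`, and `d ≥ 0`.
  have hd1 : d = 1 := by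
    rcases Int.eq_one_or_neg_one_of_mul_eq_one' (by linarith : d' * d = 1) with h | h <;> omega
  by_cases hx : x = 0
  · simp [hx]
  obtain ⟨k, hk⟩ := exists_map_eq_coe (addVal p N) hx
  rw [hd x k hk, hk, hd1, one_mul]

variable {N} in
theorem exists_addVal_algebraMap {K : Type*} [Field K] [Algebra ℚ_[p] K] [FiniteDimensional ℚ_[p] K]
    [Algebra K N] [IsScalarTower ℚ_[p] K N] (hram : IsFullyRamified p K N) {a : K} (ha : a ≠ 0) :
    ∃ t : ℤ, addVal p N (algebraMap K N a) = ((finrank K N * t : ℤ) : WithTop ℤ) := by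
  obtain ⟨ϖ, hϖ⟩ := exists_addVal_eq_one p K
  obtain ⟨t, ht⟩ := exists_map_eq_coe (addVal p K) ha
  refine ⟨t, map_ringHom_eq_mul (algebraMap K N) (fun x hx => ?_) hϖ (hram ϖ hϖ) ht⟩
  rw [zero_le_addVal_iff] at hx ⊢
  exact hx.map ((IsScalarTower.toAlgHom ℚ_[p] K N).restrictScalars ℤ_[p])

end Val

theorem hasSingleBreak_of_lowerBreaks (p : ℕ) [Fact p.Prime] {K N : Type*} [Field K]
    [Algebra ℚ_[p] K] [FiniteDimensional ℚ_[p] K] [Field N] [Algebra ℚ_[p] N]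
    [FiniteDimensional ℚ_[p] N] [Algebra K N] [IsScalarTower ℚ_[p] K N] [FiniteDimensional K N]
    (hram : IsFullyRamified p K N) {π : N} (hπ : val p N π = 1) {b : ℤ}
    (hb : lowerBreaks p K π = {b}) : HasSingleBreak p K (addVal p N) π b where
  map_gal := addVal_gal p
  map_base _ ha := exists_addVal_algebraMap p hram ha
  map_prime := one_le_addVal_prime p N
  map_uniformizer := hπ
  map_sub σ hσ := by
    have hπ' : addVal p N π = ((1 : ℤ) : WithTop ℤ) := hπ
    have hne : σ π - π ≠ 0 := fun h => hσ (gal_eq_one_of_map_uniformizer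
      (fun _ ha => exists_addVal_algebraMap p hram ha) hπ' (sub_eq_zero.mp h))
    obtain ⟨c, hc⟩ := exists_map_eq_coe (addVal p N) hne
    have hc1 : 1 ≤ c := le_of_coe_le hc ((addVal p N).map_le_sub
      ((addVal_gal p σ π).trans hπ').ge hπ'.ge)
    -- `σ` lies in `G_(c-1)` but not in `G_c`, so each nontrivial `σ` produces a break; uniqueness
    -- gives `c = b + 1`.
    have hmem : c - 1 ∈ lowerBreaks p K π := by
      refine ⟨by omega, fun τ hτ => ?_, fun hsub => ?_⟩
      · exact coe_le_mono (v := addVal p N) hτ (by omega)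
      · have h1 : σ ∈ ramificationGroup p K π (c - 1) :=
          coe_le_of_map_eq (v := addVal p N) hc (by omega)
        have h2 := le_of_coe_le (v := addVal p N) hc (hsub h1)
        omega
    rw [hb, Set.mem_singleton_iff] at hmem
    rw [hc, ← hmem, sub_add_cancel]

end LocalNormalBasis

end

open LocalNormalBasis in
theorem corollary4 (p : ℕ) [Fact p.Prime]
    (K N : Type*) [Field K] [Algebra ℚ_[p] K] [FiniteDimensional ℚ_[p] K]
    [Field N] [Algebra ℚ_[p] N] [FiniteDimensional ℚ_[p] N]
    [Algebra K N] [IsScalarTower ℚ_[p] K N] [IsGalois K N]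
    (n : ℕ) (hn : 1 < n)
    (hG : Nonempty (Gal(N/K) ≃* Multiplicative (Fin n → ZMod p)))
    (hram : IsFullyRamified p K N)
    (π : N) (hπ : val p N π = 1)
    (b : ℤ) (hb : lowerBreaks p K π = {b})
    (ρ : N) (v : ℤ) (hv : val p N ρ = v) (hρ : v ≡ b [ZMOD (p : ℤ) ^ n]) :
    GeneratesNormalBasis K ρ := by
  have : FiniteDimensional K N := FiniteDimensional.right ℚ_[p] K N
  have : CharZero K := charZero_of_injective_algebraMap (algebraMap ℚ_[p] K).injective
  have : CharZero N := charZero_of_injective_algebraMap (algebraMap ℚ_[p] N).injective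
  obtain ⟨φ⟩ := hG
  exact (hasSingleBreak_of_lowerBreaks p hram hπ hb).generatesNormalBasis hn φ hv hρ
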